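/- Let $m\ge 3$, let $D^2\subset\mathbb{R}^2$ be the open flat unit disk and let $\vec\Phi:D^2\to\mathbb{R}^m$ be a smooth immersion. Write $g_{ij}=\partial_i\vec\Phi\cdot\partial_j\vec\Phi$ for the pull-back metric, $(g^{ij})$ for its inverse, $|g|=\det(g_{ij})$, $\nabla$ for the covariant derivative of $g$, $\nabla^jf=g^{jk}\partial_kf$, $\nabla_jA^j=|g|^{-1/2}\partial_j(|g|^{1/2}A^j)$, and $\Delta_g=\nabla_j\nabla^j$ (indices are summed over $1,2$). Let $\vec h_{ij}=\nabla_i\nabla_j\vec\Phi$ be the second fundamental form, $\vec H=\frac12g^{ij}\vec h_{ij}$ the mean curvature vector, $\pi_{\vec n}$ the orthogonal projection onto the normal space, and $\Delta_\perp\vec H=\pi_{\vec n}\nabla_j(\pi_{\vec n}\nabla^j\vec H)$. Let $\epsilon^{jk}$ be the Levi-Civita symbol ($\epsilon^{12}=1=-\epsilon^{21}$, $\epsilon^{11}=\epsilon^{22}=0$), and let $\star\vec n=\frac12|g|^{-1/2}\epsilon^{ab}\,\partial_a\vec\Phi\wedge\partial_b\vec\Phi\in\Lambda^2(\mathbb{R}^m)$,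 where $\vec n$ is the Gauss map. On $\Lambda^2(\mathbb{R}^m)$, the dot is the scalar product induced from $\mathbb{R}^m$. For a 2-vector $\alpha$ and a vector $v$, the vector $\alpha\bullet v$ is defined by $(\alpha\bullet v)\cdot w=\alpha\cdot(v\wedge w)$ for all $w\in\mathbb{R}^m$; for two 2-vectors, $\bullet$ is the bilinear operation with $\alpha\bullet(b\wedge c)=(\alpha\bullet b)\wedge c-(\alpha\bullet c)\wedge b$. Suppose that $$\Delta_\perp\vec H+(\vec h^i_j\cdot\vec H)\,\vec h^j_i-2|\vec H|^2\vec H=\vec{\mathcal W}\qquad\text{on }D^2,$$ let $2\le r\le\infty$, and let $\vec V:D^2\to\mathbb{R}^m$, $\vec X:D^2\to\Lambda^2(\mathbb{R}^m)$, $Y:D^2\to\mathbb{R}$ be of class $C^r$ and solve $$\Delta_g\vec V=-\vec{\mathcal W},\qquad \Delta_g\vec X=\nabla^j\vec V\wedge\nabla_j\vec\Phi,\qquad \Delta_gY=\nabla^j\vec V\cdot\nabla_j\vec\Phi\qquad\text{on }D^2.$$ Then there exist potentials $S:D^2\to\mathbb{R}$ and $\vec R:D^2\to\Lambda^2(\mathbb{R}^m)$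 of class $C^r$ such that on $D^2$ $$|g|^{1/2}\Delta_gS=\epsilon^{jk}\,\partial_j(\star\vec n)\cdot\partial_k\vec R+|g|^{1/2}\nabla_j\big((\star\vec n)\cdot\nabla^j\vec X\big),$$ $$|g|^{1/2}\Delta_g\vec R=-\,\epsilon^{jk}\big[\partial_j(\star\vec n)\,\partial_kS+\partial_j(\star\vec n)\bullet\partial_k\vec R\big]-|g|^{1/2}\nabla_j\big((\star\vec n)\nabla^jY+(\star\vec n)\bullet\nabla^j\vec X\big),$$ and $$|g|^{1/2}\Delta_g\vec\Phi=-\,\epsilon^{jk}\big[\partial_jS\,\partial_k\vec\Phi+\partial_j\vec R\bullet\partial_k\vec\Phi\big]+|g|^{1/2}\big(\nabla^jY\,\nabla_j\vec\Phi+\nabla^j\vec X\bullet\nabla_j\vec\Phi\big).$$ -/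

import Mathlib

open scoped ContDiff RealInnerProductSpace

noncomputable section

namespace WillmoreSystem

/-- The flat plane `ℝ²`. -/
abbrev Plane := EuclideanSpace ℝ (Fin 2)

/-- The ambient Euclidean space `ℝᵐ`. -/
abbrev Amb (m : ℕ) := EuclideanSpace ℝ (Fin m)

/-- The space `Λ²(ℝᵐ)` of 2-vectors, that is, Mathlib's second exterior power with Mathlib's
inner product `⟪a ∧ b, c ∧ d⟫ = ⟪a, c⟫ ⟪b, d⟫ - ⟪a, d⟫ ⟪b, c⟫`. -/
def BiVec (m : ℕ) : Type := ⋀[ℝ]^2 (EuclideanSpace ℝ (Fin m))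

instance instNormedAddCommGroupBiVec (m : ℕ) : NormedAddCommGroup (BiVec m) :=
  inferInstanceAs (NormedAddCommGroup (⋀[ℝ]^2 (EuclideanSpace ℝ (Fin m))))

instance instInnerProductSpaceBiVec (m : ℕ) : InnerProductSpace ℝ (BiVec m) :=
  inferInstanceAs (InnerProductSpace ℝ (⋀[ℝ]^2 (EuclideanSpace ℝ (Fin m))))

/-- The flat (open) unit disk. -/
def disk : Set Plane := Metric.ball 0 1

/-- The Levi-Civita symbol: `ε¹² = 1 = -ε²¹`, `ε¹¹ = ε²² = 0`. -/
def eps : Fin 2 → Fin 2 → ℝ := ![![0, 1], ![-1, 0]]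

/-- The flat partial derivative `∂ⱼ f`. -/
def pd {F : Type*} [NormedAddCommGroup F] [NormedSpace ℝ F]
    (j : Fin 2) (f : Plane → F) (x : Plane) : F :=
  fderiv ℝ f x (EuclideanSpace.single j 1)

/-! ### 2-vectors -/

section Multivectors

variable {m : ℕ}

/-- The 2-vector `a ∧ b`. -/
def wedge (a b : Amb m) : BiVec m := exteriorPower.ιMulti ℝ 2 ![a, b]

/-- The interior multiplication `α ⌞ v` of a 2-vector with a 1-vector, which is also the
first-order contraction `α • v`. It is the vector whose `i`-th coordinate is `⟪α, v ∧ eᵢ⟫`,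
so that `⟪α ⌞ v, w⟫ = ⟪α, v ∧ w⟫` for all `w`, see `inner_contract`. -/
def contract (α : BiVec m) (v : Amb m) : Amb m :=
  WithLp.toLp 2 fun i => ⟪α, wedge v (EuclideanSpace.single i 1)⟫

/-- The first-order contraction `α • β` of two 2-vectors. It is bilinear and satisfies
`α • (b ∧ c) = (α ⌞ b) ∧ c - (α ⌞ c) ∧ b`, see `bullet_wedge`; written out in the standard basis,
this is `∑ᵢⱼ βᵢⱼ (α ⌞ eᵢ) ∧ eⱼ` where `βᵢⱼ = ⟪β, eᵢ ∧ eⱼ⟫`. -/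
def bullet (α β : BiVec m) : BiVec m :=
  ∑ i : Fin m, ∑ j : Fin m,
    ⟪β, wedge (EuclideanSpace.single i 1) (EuclideanSpace.single j 1)⟫ •
      wedge (contract α (EuclideanSpace.single i 1)) (EuclideanSpace.single j 1)

theorem inner_wedge_wedge (a b c d : Amb m) :
    ⟪wedge a b, wedge c d⟫ = ⟪a, c⟫ * ⟪b, d⟫ - ⟪a, d⟫ * ⟪b, c⟫ := by
  have h : ⟪wedge a b, wedge c d⟫ = Matrix.det (Matrix.of fun i j => ⟪![a, b] j, ![c, d] i⟫) :=
    exteriorPower.inner_ιMulti_ιMulti ![a, b] ![c, d]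
  rw [h]
  simp only [Matrix.det_fin_two, Matrix.of_apply, Matrix.cons_val_zero, Matrix.cons_val_one]
  ring

theorem update_zero_pair (a b c : Amb m) : Function.update ![a, b] 0 c = ![c, b] := by
  funext i; fin_cases i <;> rfl

theorem update_one_pair (a b c : Amb m) : Function.update ![a, b] 1 c = ![a, c] := by
  funext i; fin_cases i <;> rfl

/-- The wedge product of two vectors, as a bilinear map. -/
def wedgeₗ : Amb m →ₗ[ℝ] Amb m →ₗ[ℝ] BiVec m :=
  LinearMap.mk₂ ℝ wedge
    (fun a a' b => by
      have h := (exteriorPower.ιMulti ℝ 2 (M := Amb m)).map_update_add ![a, b] 0 a a'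
      simp only [update_zero_pair] at h
      exact h)
    (fun c a b => by
      have h := (exteriorPower.ιMulti ℝ 2 (M := Amb m)).map_update_smul ![a, b] 0 c a
      simp only [update_zero_pair] at h
      exact h)
    (fun a b b' => by
      have h := (exteriorPower.ιMulti ℝ 2 (M := Amb m)).map_update_add ![a, b] 1 b b'
      simp only [update_one_pair] at h
      exact h)
    (fun c a b => by
      have h := (exteriorPower.ιMulti ℝ 2 (M := Amb m)).map_update_smul ![a, b] 1 c b
      simp only [update_one_pair] at h
      exact h)

theorem wedgeₗ_apply (a b : Amb m) : wedgeₗ a b = wedge a b := rfl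

theorem sum_coord_smul_single (v : Amb m) :
    ∑ i, v i • (EuclideanSpace.single i (1 : ℝ) : Amb m) = v := by
  have := (EuclideanSpace.basisFun (Fin m) ℝ).sum_repr v
  simpa using this

/-- The defining property of the interior multiplication. -/
theorem inner_contract (α : BiVec m) (v w : Amb m) :
    ⟪contract α v, w⟫ = ⟪α, wedge v w⟫ := by
  conv_rhs => rw [← sum_coord_smul_single w, ← wedgeₗ_apply, map_sum]
  rw [inner_sum, PiLp.inner_apply]
  refine Finset.sum_congr rfl fun i _ => ?_
  rw [map_smul, real_inner_smul_right, wedgeₗ_apply]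
  simp [contract]

theorem contract_add_right (α : BiVec m) (v w : Amb m) :
    contract α (v + w) = contract α v + contract α w := by
  refine ext_inner_right ℝ fun u => ?_
  simp only [inner_add_left, inner_contract, ← wedgeₗ_apply, map_add, LinearMap.add_apply,
    inner_add_right]

theorem contract_smul_right (α : BiVec m) (c : ℝ) (v : Amb m) :
    contract α (c • v) = c • contract α v := by
  refine ext_inner_right ℝ fun u => ?_
  simp only [real_inner_smul_left, inner_contract, ← wedgeₗ_apply, map_smul, LinearMap.smul_apply,
    real_inner_smul_right]

/-- The inductive rule that defines the first-order contraction. -/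
theorem bullet_wedge (α : BiVec m) (b c : Amb m) :
    bullet α (wedge b c) = wedge (contract α b) c - wedge (contract α c) b := by
  have key : ∀ u v : Amb m, wedge (contract α u) v = ∑ i : Fin m, ∑ j : Fin m,
      (u i * v j) • wedge (contract α (EuclideanSpace.single i 1)) (EuclideanSpace.single j 1) := by
    intro u v
    let L : Amb m →ₗ[ℝ] Amb m :=
      { toFun := contract α
        map_add' := contract_add_right α
        map_smul' := contract_smul_right α }
    have hL : ∀ w, contract α w = L w := fun _ => rfl
    conv_lhs => rw [← sum_coord_smul_single u, ← sum_coord_smul_single v, ← wedgeₗ_apply, hL]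
    simp only [map_sum, map_smul, LinearMap.sum_apply, LinearMap.smul_apply, Finset.smul_sum,
      smul_smul, wedgeₗ_apply, hL]
    rw [Finset.sum_comm]
    refine Finset.sum_congr rfl fun i _ => Finset.sum_congr rfl fun j _ => ?_
    rw [mul_comm]
  rw [key b c, key c b, ← Finset.sum_sub_distrib]
  unfold bullet
  refine Finset.sum_congr rfl fun i _ => ?_
  rw [← Finset.sum_sub_distrib]
  refine Finset.sum_congr rfl fun j _ => ?_
  have hin : ⟪wedge b c, wedge (EuclideanSpace.single i 1) (EuclideanSpace.single j 1)⟫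
      = b i * c j - c i * b j := by
    rw [inner_wedge_wedge]
    simp [EuclideanSpace.inner_single_right]
    ring
  rw [hin]
  exact sub_smul _ _ _

end Multivectors

/-! ### Geometry of the immersion `Φ` in the coordinates of the disk -/

section Geometry

variable {m : ℕ} (Φ : Plane → Amb m)

/-- The components `gᵢⱼ = ∂ᵢΦ · ∂ⱼΦ` of the pull-back metric. -/
def metric (x : Plane) : Matrix (Fin 2) (Fin 2) ℝ :=
  Matrix.of fun i j => ⟪pd i Φ x, pd j Φ x⟫

/-- The components `gⁱʲ` of the inverse metric. -/
def metricInv (x : Plane) : Matrix (Fin 2) (Fin 2) ℝ := (metric Φ x)⁻¹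

/-- `|g|^{1/2}`, where `|g| = det (gᵢⱼ)`. -/
def sqrtg (x : Plane) : ℝ := Real.sqrt (metric Φ x).det

/-- The Christoffel symbols `Γᵏᵢⱼ` of the metric `g`. -/
def christoffel (k i j : Fin 2) (x : Plane) : ℝ :=
  (1 / 2) * ∑ l, metricInv Φ x k l *
    (pd i (fun y => metric Φ y j l) x + pd j (fun y => metric Φ y i l) x
      - pd l (fun y => metric Φ y i j) x)

/-- The raised derivative `∇ʲ f = gʲᵏ ∂ₖ f` of a scalar, vector or 2-vector valued function. -/
def gradUp {F : Type*} [NormedAddCommGroup F] [NormedSpace ℝ F]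
    (f : Plane → F) (j : Fin 2) (x : Plane) : F :=
  ∑ k, metricInv Φ x j k • pd k f x

/-- The covariant divergence `∇ⱼ Aʲ = |g|^{-1/2} ∂ⱼ (|g|^{1/2} Aʲ)`. -/
def covDiv {F : Type*} [NormedAddCommGroup F] [NormedSpace ℝ F]
    (A : Fin 2 → Plane → F) (x : Plane) : F :=
  (sqrtg Φ x)⁻¹ • ∑ j, pd j (fun y => sqrtg Φ y • A j y) x

/-- The (negative) Laplace-Beltrami operator `Δ_g f = ∇ⱼ∇ʲ f`. -/
def laplace {F : Type*} [NormedAddCommGroup F] [NormedSpace ℝ F]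
    (f : Plane → F) (x : Plane) : F :=
  covDiv Φ (gradUp Φ f) x

/-- The second fundamental form `hᵢⱼ = ∇ᵢ∇ⱼΦ = ∂ᵢ∂ⱼΦ - Γᵏᵢⱼ ∂ₖΦ`. -/
def secondFF (i j : Fin 2) (x : Plane) : Amb m :=
  pd i (pd j Φ) x - ∑ k, christoffel Φ k i j x • pd k Φ x

/-- The mixed components `hⁱⱼ = gⁱᵏ hₖⱼ` of the second fundamental form. -/
def secondFFMixed (i j : Fin 2) (x : Plane) : Amb m :=
  ∑ k, metricInv Φ x i k • secondFF Φ k j x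

/-- The mean curvature vector `H = ½ gⁱʲ hᵢⱼ`. -/
def meanCurv (x : Plane) : Amb m :=
  (1 / 2 : ℝ) • ∑ i, ∑ j, metricInv Φ x i j • secondFF Φ i j x

/-- The projection onto the normal space: `v - gⁱʲ (v · ∂ᵢΦ) ∂ⱼΦ`. -/
def normalProj (x : Plane) (v : Amb m) : Amb m :=
  v - ∑ i, ∑ j, (metricInv Φ x i j * ⟪v, pd i Φ x⟫) • pd j Φ x

/-- The (negative) Laplacian of the normal connection `π_n ∇` on normal fields:
`Δ_⊥ ν = π_n ∇ⱼ (π_n ∇ʲ ν)`. -/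
def normalLaplace (ν : Plane → Amb m) (x : Plane) : Amb m :=
  normalProj Φ x (covDiv Φ (fun j y => normalProj Φ y (gradUp Φ ν j y)) x)

/-- The Willmore operator `Δ_⊥ H + (hⁱⱼ · H) hʲᵢ - 2 |H|² H`. -/
def willmoreOp (x : Plane) : Amb m :=
  normalLaplace Φ (meanCurv Φ) x
    + ∑ i, ∑ j, ⟪secondFFMixed Φ i j x, meanCurv Φ x⟫ • secondFFMixed Φ j i x
    - (2 * ‖meanCurv Φ x‖ ^ 2) • meanCurv Φ x

/-- The 2-vector `⋆n = ½ |g|^{-1/2} εᵃᵇ ∂ₐΦ ∧ ∂_bΦ`, where `n` is the Gauss map. -/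
def starN (x : Plane) : BiVec m :=
  ((1 / 2) * (sqrtg Φ x)⁻¹) • ∑ a, ∑ b, eps a b • wedge (pd a Φ x) (pd b Φ x)

end Geometry

end WillmoreSystem

end

open WillmoreSystem

open scoped ContDiff RealInnerProductSpace
open WillmoreSystem

noncomputable section

namespace WillmoreSystem

/-! ### Partial derivatives on the disk -/

section Calculus

variable {E F G : Type*} [NormedAddCommGroup E] [NormedSpace ℝ E]
  [NormedAddCommGroup F] [NormedSpace ℝ F] [NormedAddCommGroup G] [NormedSpace ℝ G]

/-! Write T for the density `stress` and ∇ʲf for the density `gradDens Φ f j`, so that divergences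
become plain sums of ∂ⱼ and no conformal coordinates are needed. Translation invariance of the
Willmore energy makes its operator a divergence: ∂ⱼTʲ = -|g|^{1/2} W (`div_stress`). Since V solves
Δ_g V = -W, the field Tʲ - ∇ʲV is divergence free, and the Poincaré lemma on the disk
(`exists_potential`) writes it as εʲᵏ∂ₖL.

Dilation and rotation invariance appear as Tʲ · ∂ⱼΦ = 0 (`sum_inner_stress`) and Tʲ ∧ ∂ⱼΦ = -∂ⱼ(H ∧
∇ʲΦ) (`sum_wedge_stress`). Hence the curl of the form L · ∂ᵢΦ is ∇ʲV · ∂ⱼΦ, which is the divergence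
of ∇ʲY, and the curl of L ∧ ∂ᵢΦ is the divergence of ∇ʲX + H ∧ ∇ʲΦ. Adding the rotated fields makes
both forms closed; S and R are their primitives.

It remains to eliminate L and H. Pairing L ∧ dΦ with ⋆n returns the rotated form L · dΦ
(`inner_starN_wedge`), and `bullet_starN_wedge` is the analogue for the contraction of 2-vectors.
This gives first-order relations among S, R, X, Y (`gradDens_scalar`, `gradDens_bivec`). Their
divergences are the equations for S and R, because εʲᵏ∂ⱼ∂ₖ vanishes. In the equation for Φ the terms
with L cancel by antisymmetry, those with X and Y cancel the source, and H ∧ ∇Φ leaves 2H, that is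
Δ_g Φ (`div_gradDens`). -/

theorem isOpen_disk : IsOpen disk := Metric.isOpen_ball

theorem convex_disk : Convex ℝ disk := convex_ball 0 1

theorem disk_mem_nhds {x : Plane} (hx : x ∈ disk) : disk ∈ nhds x := isOpen_disk.mem_nhds hx

theorem differentiableAt_of_contDiffOn {n : WithTop ℕ∞} {f : Plane → F} (hf : ContDiffOn ℝ n f disk)
    (hn : n ≠ 0) {x : Plane} (hx : x ∈ disk) : DifferentiableAt ℝ f x :=
  (hf.differentiableOn hn).differentiableAt (disk_mem_nhds hx)

theorem contDiffOn_pd {n k : WithTop ℕ∞} {f : Plane → F} (hf : ContDiffOn ℝ n f disk)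
    (hk : k + 1 ≤ n) (j : Fin 2) : ContDiffOn ℝ k (pd j f) disk :=
  (hf.fderiv_of_isOpen isOpen_disk hk).clm_apply contDiffOn_const

theorem smooth_pd {f : Plane → F} (hf : ContDiffOn ℝ ∞ f disk) (j : Fin 2) :
    ContDiffOn ℝ ∞ (pd j f) disk :=
  contDiffOn_pd hf (by simp) j

theorem pd_congr {f g : Plane → F} (h : ∀ x ∈ disk, f x = g x) (j : Fin 2) {x : Plane}
    (hx : x ∈ disk) : pd j f x = pd j g x := by
  have : f =ᶠ[nhds x] g := Filter.mem_of_superset (disk_mem_nhds hx) h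
  unfold pd
  rw [this.fderiv_eq]

theorem pd_add {f g : Plane → F} {x : Plane} (hf : DifferentiableAt ℝ f x)
    (hg : DifferentiableAt ℝ g x) (j : Fin 2) :
    pd j (fun y => f y + g y) x = pd j f x + pd j g x := by
  simp [pd, fderiv_fun_add hf hg]

theorem pd_sub {f g : Plane → F} {x : Plane} (hf : DifferentiableAt ℝ f x)
    (hg : DifferentiableAt ℝ g x) (j : Fin 2) :
    pd j (fun y => f y - g y) x = pd j f x - pd j g x := by
  simp [pd, fderiv_fun_sub hf hg]

theorem pd_neg (f : Plane → F) (x : Plane) (j : Fin 2) :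
    pd j (fun y => - f y) x = - pd j f x := by
  simp [pd, fderiv_fun_neg]

theorem pd_bilin (B : E →L[ℝ] F →L[ℝ] G) {f : Plane → E} {g : Plane → F} {x : Plane}
    (hf : DifferentiableAt ℝ f x) (hg : DifferentiableAt ℝ g x) (j : Fin 2) :
    pd j (fun y => B (f y) (g y)) x = B (pd j f x) (g x) + B (f x) (pd j g x) := by
  have := (B.hasFDerivAt_of_bilinear hf.hasFDerivAt hg.hasFDerivAt).fderiv
  simp only [pd, this]
  simp [add_comm]

theorem contDiffOn_bilin (B : E →L[ℝ] F →L[ℝ] G) {n : WithTop ℕ∞} {f : Plane → E} {g : Plane → F}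
    {s : Set Plane} (hf : ContDiffOn ℝ n f s) (hg : ContDiffOn ℝ n g s) :
    ContDiffOn ℝ n (fun y => B (f y) (g y)) s :=
  (B.contDiff.comp_contDiffOn hf).clm_apply hg

theorem pd_smul {c : Plane → ℝ} {f : Plane → F} {x : Plane} (hc : DifferentiableAt ℝ c x)
    (hf : DifferentiableAt ℝ f x) (j : Fin 2) :
    pd j (fun y => c y • f y) x = pd j c x • f x + c x • pd j f x :=
  pd_bilin (ContinuousLinearMap.lsmul ℝ ℝ) hc hf j

theorem pd_mul {c d : Plane → ℝ} {x : Plane} (hc : DifferentiableAt ℝ c x)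
    (hd : DifferentiableAt ℝ d x) (j : Fin 2) :
    pd j (fun y => c y * d y) x = pd j c x * d x + c x * pd j d x :=
  pd_smul hc hd j

theorem pd_inner {H : Type*} [NormedAddCommGroup H] [InnerProductSpace ℝ H] {f g : Plane → H}
    {x : Plane} (hf : DifferentiableAt ℝ f x) (hg : DifferentiableAt ℝ g x) (j : Fin 2) :
    pd j (fun y => ⟪f y, g y⟫) x = ⟪pd j f x, g x⟫ + ⟪f x, pd j g x⟫ :=
  pd_bilin (innerSL ℝ) hf hg j

/-- Symmetry of second derivatives. -/
theorem pd_comm {n : WithTop ℕ∞} {f : Plane → F} (hf : ContDiffOn ℝ n f disk) (hn : 2 ≤ n)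
    (i j : Fin 2) {x : Plane} (hx : x ∈ disk) : pd i (pd j f) x = pd j (pd i f) x := by
  have hd : DifferentiableAt ℝ (fderiv ℝ f) x :=
    differentiableAt_of_contDiffOn
      (hf.fderiv_of_isOpen isOpen_disk (m := 1) (by rwa [one_add_one_eq_two])) one_ne_zero hx
  have hsymm : IsSymmSndFDerivAt ℝ f x :=
    (hf.contDiffAt (disk_mem_nhds hx)).isSymmSndFDerivAt (by simpa using hn)
  have h : ∀ k l : Fin 2, pd k (pd l f) x
      = fderiv ℝ (fderiv ℝ f) x (EuclideanSpace.single k 1) (EuclideanSpace.single l 1) := by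
    intro k l
    unfold pd
    rw [fderiv_clm_apply hd (differentiableAt_const _)]
    simp
  rw [h, h, hsymm]

theorem plane_eq (u : Plane) :
    u = u 0 • EuclideanSpace.single 0 (1 : ℝ) + u 1 • EuclideanSpace.single 1 (1 : ℝ) := by
  ext i; fin_cases i <;> simp

/-- The Poincaré lemma on the disk: a closed 1-form of class `C^q`, `q ≥ 1`, has a potential of
class `C^{q+1}`. -/
theorem exists_potential [CompleteSpace F] {q : ℕ∞} (hq : 1 ≤ q) (a : Fin 2 → Plane → F)
    (ha : ∀ j, ContDiffOn ℝ q (a j) disk) (hcurl : ∀ x ∈ disk, pd 0 (a 1) x = pd 1 (a 0) x) :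
    ∃ u : Plane → F, ContDiffOn ℝ (q + 1 : ℕ∞) u disk ∧ ∀ x ∈ disk, ∀ j, pd j u x = a j x := by
  let pr : Fin 2 → Plane →L[ℝ] ℝ := fun j => EuclideanSpace.proj j
  let θ : Plane → Plane →L[ℝ] F := fun x => (pr 0).smulRight (a 0 x) + (pr 1).smulRight (a 1 x)
  have hθ : ContDiffOn ℝ q θ disk :=
    ((ContinuousLinearMap.smulRightL ℝ Plane F (pr 0)).contDiff.comp_contDiffOn (ha 0)).add
      ((ContinuousLinearMap.smulRightL ℝ Plane F (pr 1)).contDiff.comp_contDiffOn (ha 1))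
  have hq0 : (q : WithTop ℕ∞) ≠ 0 := by
    intro h
    have : q = 0 := by exact_mod_cast h
    simp [this] at hq
  have hdθ : ∀ x ∈ disk, ∀ u v : Plane, fderiv ℝ θ x u v
      = u 0 • v 0 • pd 0 (a 0) x + u 1 • v 0 • pd 1 (a 0) x + u 0 • v 1 • pd 0 (a 1) x
        + u 1 • v 1 • pd 1 (a 1) x := by
    intro x hx u v
    have h0 := (differentiableAt_of_contDiffOn (ha 0) hq0 hx).hasFDerivAt
    have h1 := (differentiableAt_of_contDiffOn (ha 1) hq0 hx).hasFDerivAt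
    have h : HasFDerivAt θ
        ((ContinuousLinearMap.smulRightL ℝ Plane F (pr 0)).comp (fderiv ℝ (a 0) x)
          + (ContinuousLinearMap.smulRightL ℝ Plane F (pr 1)).comp (fderiv ℝ (a 1) x)) x :=
      ((ContinuousLinearMap.smulRightL ℝ Plane F (pr 0)).hasFDerivAt.comp x h0).add
        ((ContinuousLinearMap.smulRightL ℝ Plane F (pr 1)).hasFDerivAt.comp x h1)
    have h2 : ∀ j, fderiv ℝ (a j) x u = u 0 • pd 0 (a j) x + u 1 • pd 1 (a j) x := by
      intro j
      conv_lhs => rw [plane_eq u]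
      simp [pd]
    have hpr : ∀ j, pr j v = v j := fun _ => rfl
    rw [h.fderiv]
    simp only [add_apply, ContinuousLinearMap.comp_apply,
      ContinuousLinearMap.smulRightL_apply_apply, ContinuousLinearMap.smulRight_apply, h2,
      hpr]
    module
  -- In two variables symmetry of the derivative of θ amounts to the single curl equation.
  obtain ⟨u, hu⟩ := convex_disk.exists_forall_hasFDerivAt_of_fderiv_symmetric isOpen_disk
    (hθ.differentiableOn hq0) (fun x hx v w => by
      rw [hdθ x hx, hdθ x hx, hcurl x hx]
      module)
  refine ⟨u, ?_, fun x hx j => ?_⟩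
  · rw [show ((q + 1 : ℕ∞) : WithTop ℕ∞) = (q : WithTop ℕ∞) + 1 by push_cast; rfl]
    rw [contDiffOn_succ_iff_fderiv_of_isOpen isOpen_disk]
    -- The middle condition concerns only the analytic exponent, which a cast from `ℕ∞` never
    -- equals.
    refine ⟨fun x hx => (hu x hx).differentiableAt.differentiableWithinAt, by simp, ?_⟩
    exact hθ.congr fun x hx => (hu x hx).fderiv
  · unfold pd
    rw [(hu x hx).fderiv]
    fin_cases j <;> simp [θ, pr]

end Calculus

/-! ### Bilinear operations on 2-vectors -/

section Bilinear

variable {m : ℕ}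

instance instFiniteDimensionalBiVec (m : ℕ) : FiniteDimensional ℝ (BiVec m) :=
  inferInstanceAs (FiniteDimensional ℝ (⋀[ℝ]^2 (EuclideanSpace ℝ (Fin m))))

/-- Decomposable 2-vectors span, so a linear functional that kills them is zero. -/
theorem bivec_ext {α β : BiVec m} (h : ∀ a b : Amb m, ⟪α, wedge a b⟫ = ⟪β, wedge a b⟫) :
    α = β := by
  refine ext_inner_right ℝ fun w => ?_
  let P : ⋀[ℝ]^2 (EuclideanSpace ℝ (Fin m)) →ₗ[ℝ] ℝ :=
    innerₛₗ ℝ (E := ⋀[ℝ]^2 (EuclideanSpace ℝ (Fin m))) (α - β)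
  have hP : P = 0 := by
    refine exteriorPower.linearMap_ext (AlternatingMap.ext fun v => ?_)
    have hv : v = ![v 0, v 1] := by funext i; fin_cases i <;> rfl
    rw [hv]
    have h1 : ⟪α - β, wedge (v 0) (v 1)⟫ = 0 := by rw [inner_sub_left, h, sub_self]
    exact h1
  have hw : ⟪α - β, w⟫ = 0 := LinearMap.congr_fun hP w
  rwa [inner_sub_left, sub_eq_zero] at hw

@[simp] theorem wedge_add_left (a b c : Amb m) : wedge (a + b) c = wedge a c + wedge b c := by
  simp [← wedgeₗ_apply]

@[simp] theorem wedge_add_right (a b c : Amb m) : wedge a (b + c) = wedge a b + wedge a c := by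
  simp [← wedgeₗ_apply]

@[simp] theorem wedge_sub_left (a b c : Amb m) : wedge (a - b) c = wedge a c - wedge b c := by
  simp [← wedgeₗ_apply]

@[simp] theorem wedge_smul_left (r : ℝ) (a b : Amb m) : wedge (r • a) b = r • wedge a b := by
  simp [← wedgeₗ_apply]

@[simp] theorem wedge_smul_right (r : ℝ) (a b : Amb m) : wedge a (r • b) = r • wedge a b := by
  simp [← wedgeₗ_apply]

@[simp] theorem wedge_neg_left (a b : Amb m) : wedge (-a) b = - wedge a b := by
  simp [← wedgeₗ_apply]

@[simp] theorem wedge_zero_left (a : Amb m) : wedge 0 a = 0 := by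
  simp [← wedgeₗ_apply]

theorem wedge_swap (a b : Amb m) : wedge a b = - wedge b a := by
  refine bivec_ext fun c d => ?_
  rw [inner_neg_left, inner_wedge_wedge, inner_wedge_wedge]
  ring

@[simp] theorem wedge_self (a : Amb m) : wedge a a = 0 := by
  refine bivec_ext fun c d => ?_
  rw [inner_zero_left, inner_wedge_wedge]
  ring

theorem contract_wedge (a b v : Amb m) : contract (wedge a b) v = ⟪a, v⟫ • b - ⟪b, v⟫ • a := by
  refine ext_inner_right ℝ fun w => ?_
  rw [inner_contract, inner_wedge_wedge, inner_sub_left, real_inner_smul_left,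
    real_inner_smul_left]
  ring

/-- The wedge product as a continuous bilinear map. -/
def wedgeL : Amb m →L[ℝ] Amb m →L[ℝ] BiVec m :=
  LinearMap.toContinuousLinearMap
    ((LinearMap.toContinuousLinearMap : (Amb m →ₗ[ℝ] BiVec m) ≃ₗ[ℝ] (Amb m →L[ℝ] BiVec m)) ∘ₗ wedgeₗ)

theorem contract_add_left (α β : BiVec m) (v : Amb m) :
    contract (α + β) v = contract α v + contract β v := by
  refine ext_inner_right ℝ fun u => ?_
  simp only [inner_add_left, inner_contract]

theorem contract_smul_left (c : ℝ) (α : BiVec m) (v : Amb m) :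
    contract (c • α) v = c • contract α v := by
  refine ext_inner_right ℝ fun u => ?_
  simp only [real_inner_smul_left, inner_contract]

/-- The contraction of a 2-vector with a vector as a continuous bilinear map. -/
def contractL : BiVec m →L[ℝ] Amb m →L[ℝ] Amb m :=
  LinearMap.toContinuousLinearMap
    ((LinearMap.toContinuousLinearMap : (Amb m →ₗ[ℝ] Amb m) ≃ₗ[ℝ] (Amb m →L[ℝ] Amb m)) ∘ₗ
      LinearMap.mk₂ ℝ contract contract_add_left contract_smul_left contract_add_right
        (fun c α v => contract_smul_right α c v))

@[simp] theorem contractL_apply (α : BiVec m) (v : Amb m) : contractL α v = contract α v := rfl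

theorem bullet_add_left (α β γ : BiVec m) : bullet (α + β) γ = bullet α γ + bullet β γ := by
  simp only [bullet, contract_add_left, wedge_add_left, smul_add, Finset.sum_add_distrib]

theorem bullet_smul_left (c : ℝ) (α γ : BiVec m) : bullet (c • α) γ = c • bullet α γ := by
  simp only [bullet, contract_smul_left, wedge_smul_left, Finset.smul_sum, smul_comm c]

theorem bullet_add_right (α β γ : BiVec m) : bullet α (β + γ) = bullet α β + bullet α γ := by
  simp only [bullet, inner_add_left, add_smul, Finset.sum_add_distrib]

theorem bullet_smul_right (c : ℝ) (α γ : BiVec m) : bullet α (c • γ) = c • bullet α γ := by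
  simp only [bullet, real_inner_smul_left, mul_smul, Finset.smul_sum]

/-- The first-order contraction of two 2-vectors as a continuous bilinear map. -/
def bulletL : BiVec m →L[ℝ] BiVec m →L[ℝ] BiVec m :=
  LinearMap.toContinuousLinearMap
    ((LinearMap.toContinuousLinearMap : (BiVec m →ₗ[ℝ] BiVec m) ≃ₗ[ℝ] (BiVec m →L[ℝ] BiVec m)) ∘ₗ
      LinearMap.mk₂ ℝ bullet bullet_add_left bullet_smul_left bullet_add_right
        (fun c α v => bullet_smul_right c α v))

@[simp] theorem bulletL_apply (α β : BiVec m) : bulletL α β = bullet α β := rfl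

theorem pd_wedge {f g : Plane → Amb m} {x : Plane} (hf : DifferentiableAt ℝ f x)
    (hg : DifferentiableAt ℝ g x) (j : Fin 2) :
    pd j (fun y => wedge (f y) (g y)) x = wedge (pd j f x) (g x) + wedge (f x) (pd j g x) :=
  pd_bilin wedgeL hf hg j

theorem contDiffOn_wedge {n : WithTop ℕ∞} {s : Set Plane} {f g : Plane → Amb m}
    (hf : ContDiffOn ℝ n f s) (hg : ContDiffOn ℝ n g s) :
    ContDiffOn ℝ n (fun y => wedge (f y) (g y)) s :=
  contDiffOn_bilin wedgeL hf hg

theorem contDiffOn_bullet {n : WithTop ℕ∞} {s : Set Plane} {f g : Plane → BiVec m}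
    (hf : ContDiffOn ℝ n f s) (hg : ContDiffOn ℝ n g s) :
    ContDiffOn ℝ n (fun y => bullet (f y) (g y)) s :=
  contDiffOn_bilin bulletL hf hg

end Bilinear

/-! ### The pull-back metric -/

section Metric

variable {m : ℕ} {Φ : Plane → Amb m}

/-- A smooth immersion of the disk. -/
structure IsImmersion (Φ : Plane → Amb m) : Prop where
  smooth : ContDiffOn ℝ ∞ Φ disk
  injective : ∀ x ∈ disk, Function.Injective (fderiv ℝ Φ x)

/-- The densitized inverse metric `|g|^{1/2} gʲᵏ`. -/
def densInv (Φ : Plane → Amb m) (j k : Fin 2) (x : Plane) : ℝ :=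
  sqrtg Φ x * metricInv Φ x j k

/-- The densitized gradient `|g|^{1/2} ∇ʲ f`. -/
def gradDens {F : Type*} [NormedAddCommGroup F] [NormedSpace ℝ F] (Φ : Plane → Amb m)
    (f : Plane → F) (j : Fin 2) (x : Plane) : F :=
  ∑ k, densInv Φ j k x • pd k f x

theorem metric_symm (x : Plane) (i j : Fin 2) : metric Φ x i j = metric Φ x j i := by
  simp [metric, real_inner_comm]

theorem metricInv_symm (x : Plane) (i j : Fin 2) : metricInv Φ x i j = metricInv Φ x j i := by
  have h : (metric Φ x).transpose = metric Φ x := Matrix.ext fun i j => metric_symm x j i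
  have h2 : (metricInv Φ x).transpose = metricInv Φ x := by
    rw [metricInv, Matrix.transpose_nonsing_inv, h]
  exact congrFun (congrFun h2 j) i

theorem densInv_symm (x : Plane) (i j : Fin 2) : densInv Φ i j x = densInv Φ j i x := by
  rw [densInv, metricInv_symm, densInv]

theorem sqrtg_smul_gradUp {F : Type*} [NormedAddCommGroup F] [NormedSpace ℝ F] (f : Plane → F)
    (j : Fin 2) (x : Plane) : sqrtg Φ x • gradUp Φ f j x = gradDens Φ f j x := by
  simp only [gradUp, gradDens, densInv, Finset.smul_sum, mul_smul]

namespace IsImmersion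

variable (h : IsImmersion Φ) {x : Plane} (hx : x ∈ disk)

include h

theorem smooth_pd (i : Fin 2) : ContDiffOn ℝ ∞ (pd i Φ) disk := WillmoreSystem.smooth_pd h.smooth i

theorem smooth_pd_pd (i j : Fin 2) : ContDiffOn ℝ ∞ (pd i (pd j Φ)) disk :=
  WillmoreSystem.smooth_pd (h.smooth_pd j) i

theorem smooth_metric (i j : Fin 2) : ContDiffOn ℝ ∞ (fun y => metric Φ y i j) disk := by
  simp only [metric, Matrix.of_apply]
  exact (h.smooth_pd i).inner ℝ (h.smooth_pd j)

include hx

theorem pd_comm (i j : Fin 2) : pd i (pd j Φ) x = pd j (pd i Φ) x :=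
  WillmoreSystem.pd_comm h.smooth (WithTop.coe_le_coe.2 (le_top : (2 : ℕ∞) ≤ ⊤)) i j hx

theorem eq_zero_of_tangent {a b : ℝ} (hab : a • pd 0 Φ x + b • pd 1 Φ x = 0) : a = 0 ∧ b = 0 := by
  have h0 : fderiv ℝ Φ x (a • EuclideanSpace.single 0 1 + b • EuclideanSpace.single 1 1) = 0 := by
    simpa [pd] using hab
  have h1 := h.injective x hx (h0.trans (map_zero _).symm)
  constructor
  · simpa using congrArg (fun v : Plane => v 0) h1
  · simpa using congrArg (fun v : Plane => v 1) h1

theorem metric_zero_pos : 0 < metric Φ x 0 0 := by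
  have : pd 0 Φ x ≠ 0 := fun h0 => by
    simpa using (h.eq_zero_of_tangent hx (a := 1) (b := 0) (by simp [h0])).1
  exact real_inner_self_pos.2 this

theorem metric_det_pos : 0 < (metric Φ x).det := by
  -- This is g₀₀ times the component of ∂₁Φ orthogonal to ∂₀Φ; its squared length is g₀₀ det g.
  set v : Amb m := (-metric Φ x 0 1) • pd 0 Φ x + metric Φ x 0 0 • pd 1 Φ x with hv
  have hv0 : v ≠ 0 := fun h0 => (h.metric_zero_pos hx).ne' (h.eq_zero_of_tangent hx h0).2
  have h1 : ⟪v, v⟫ = metric Φ x 0 0 * (metric Φ x).det := by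
    rw [Matrix.det_fin_two, hv]
    simp only [inner_add_left, inner_add_right, real_inner_smul_left, real_inner_smul_right,
      metric, Matrix.of_apply, real_inner_comm (pd 0 Φ x) (pd 1 Φ x)]
    ring
  have h2 : 0 < ⟪v, v⟫ := real_inner_self_pos.2 hv0
  rw [h1] at h2
  exact (mul_pos_iff_of_pos_left (h.metric_zero_pos hx)).1 h2

theorem sqrtg_pos : 0 < sqrtg Φ x := Real.sqrt_pos.2 (h.metric_det_pos hx)

theorem sqrtg_ne : sqrtg Φ x ≠ 0 := (h.sqrtg_pos hx).ne'

theorem sqrtg_sq : sqrtg Φ x ^ 2 = metric Φ x 0 0 * metric Φ x 1 1 - metric Φ x 0 1 ^ 2 := by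
  rw [sqrtg, Real.sq_sqrt (h.metric_det_pos hx).le, Matrix.det_fin_two, metric_symm x 1 0]
  ring

theorem metricInv_mul (i l : Fin 2) :
    ∑ k, metricInv Φ x i k * metric Φ x k l = if i = l then 1 else 0 := by
  have h1 := Matrix.nonsing_inv_mul (metric Φ x) (h.metric_det_pos hx).ne'.isUnit
  have h2 := congrFun (congrFun h1 i) l
  rwa [Matrix.mul_apply, Matrix.one_apply] at h2

theorem metricInv_eq : metricInv Φ x 0 0 = metric Φ x 1 1 / sqrtg Φ x ^ 2 ∧
    metricInv Φ x 0 1 = - metric Φ x 0 1 / sqrtg Φ x ^ 2 ∧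
    metricInv Φ x 1 0 = - metric Φ x 0 1 / sqrtg Φ x ^ 2 ∧
    metricInv Φ x 1 1 = metric Φ x 0 0 / sqrtg Φ x ^ 2 := by
  have hs : sqrtg Φ x ^ 2 = (metric Φ x).det := Real.sq_sqrt (h.metric_det_pos hx).le
  rw [hs]
  simp only [metricInv, Matrix.inv_def, Matrix.adjugate_fin_two, metric_symm x 1 0]
  simp [div_eq_inv_mul]

theorem densInv_eq : densInv Φ 0 0 x = metric Φ x 1 1 / sqrtg Φ x ∧
    densInv Φ 0 1 x = - metric Φ x 0 1 / sqrtg Φ x ∧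
    densInv Φ 1 0 x = - metric Φ x 0 1 / sqrtg Φ x ∧
    densInv Φ 1 1 x = metric Φ x 0 0 / sqrtg Φ x := by
  obtain ⟨h1, h2, h3, h4⟩ := h.metricInv_eq hx
  have hs := h.sqrtg_ne hx
  simp only [densInv, h1, h2, h3, h4]
  refine ⟨?_, ?_, ?_, ?_⟩ <;> field_simp

omit hx

theorem smooth_sqrtg : ContDiffOn ℝ ∞ (sqrtg Φ) disk := by
  have h1 : ContDiffOn ℝ ∞ (fun y => (metric Φ y).det) disk := by
    simp only [Matrix.det_fin_two]
    exact ((h.smooth_metric 0 0).mul (h.smooth_metric 1 1)).sub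
      ((h.smooth_metric 0 1).mul (h.smooth_metric 1 0))
  exact h1.sqrt fun x hx => (h.metric_det_pos hx).ne'

theorem smooth_metricInv (i j : Fin 2) : ContDiffOn ℝ ∞ (fun y => metricInv Φ y i j) disk := by
  have hs := h.smooth_sqrtg.pow 2
  have hne : ∀ x ∈ disk, sqrtg Φ x ^ 2 ≠ 0 := fun x hx => pow_ne_zero 2 (h.sqrtg_ne hx)
  have h00 := (h.smooth_metric 1 1).div hs hne
  have h01 := (h.smooth_metric 0 1).neg.div hs hne
  have h11 := (h.smooth_metric 0 0).div hs hne
  fin_cases i <;> fin_cases j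
  · exact h00.congr fun x hx => (h.metricInv_eq hx).1
  · exact h01.congr fun x hx => (h.metricInv_eq hx).2.1
  · exact h01.congr fun x hx => (h.metricInv_eq hx).2.2.1
  · exact h11.congr fun x hx => (h.metricInv_eq hx).2.2.2

theorem smooth_densInv (i j : Fin 2) : ContDiffOn ℝ ∞ (densInv Φ i j) disk :=
  h.smooth_sqrtg.mul (h.smooth_metricInv i j)

theorem contDiffOn_gradDens {F : Type*} [NormedAddCommGroup F] [NormedSpace ℝ F] {q n : ℕ∞}
    {f : Plane → F} (hf : ContDiffOn ℝ n f disk) (hq : q + 1 ≤ n) (j : Fin 2) :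
    ContDiffOn ℝ q (gradDens Φ f j) disk :=
  ContDiffOn.sum fun k _ => ((h.smooth_densInv j k).of_le (by exact_mod_cast le_top)).smul
    (contDiffOn_pd hf (by exact_mod_cast hq) k)

theorem smooth_gradDens {F : Type*} [NormedAddCommGroup F] [NormedSpace ℝ F]
    {f : Plane → F} (hf : ContDiffOn ℝ ∞ f disk) (j : Fin 2) :
    ContDiffOn ℝ ∞ (gradDens Φ f j) disk :=
  h.contDiffOn_gradDens (n := ⊤) (q := ⊤) hf (by simp) j

include hx

theorem densInv_mul (i l : Fin 2) :
    ∑ k, densInv Φ i k x * metric Φ x k l = if i = l then sqrtg Φ x else 0 := by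
  simp only [densInv, mul_assoc, ← Finset.mul_sum, h.metricInv_mul hx]
  simp

theorem sqrtg_smul_covDiv {F : Type*} [NormedAddCommGroup F] [NormedSpace ℝ F]
    (A : Fin 2 → Plane → F) :
    sqrtg Φ x • covDiv Φ A x = ∑ j, pd j (fun y => sqrtg Φ y • A j y) x := by
  rw [covDiv, smul_smul, mul_inv_cancel₀ (h.sqrtg_ne hx), one_smul]

theorem sqrtg_smul_laplace {F : Type*} [NormedAddCommGroup F] [NormedSpace ℝ F]
    (f : Plane → F) : sqrtg Φ x • laplace Φ f x = ∑ j, pd j (gradDens Φ f j) x := by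
  rw [laplace, h.sqrtg_smul_covDiv hx]
  simp only [sqrtg_smul_gradUp]

theorem pd_metric (l i j : Fin 2) : pd l (fun y => metric Φ y i j) x
    = ⟪pd l (pd i Φ) x, pd j Φ x⟫ + ⟪pd i Φ x, pd l (pd j Φ) x⟫ := by
  simp only [metric, Matrix.of_apply]
  exact pd_inner (differentiableAt_of_contDiffOn (h.smooth_pd i) (by simp) hx)
    (differentiableAt_of_contDiffOn (h.smooth_pd j) (by simp) hx) l

theorem two_mul_sqrtg_mul_pd_sqrtg (l : Fin 2) : 2 * sqrtg Φ x * pd l (sqrtg Φ) x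
    = pd l (fun y => metric Φ y 0 0) x * metric Φ x 1 1
      + metric Φ x 0 0 * pd l (fun y => metric Φ y 1 1) x
      - 2 * metric Φ x 0 1 * pd l (fun y => metric Φ y 0 1) x := by
  have hd : ∀ i j, DifferentiableAt ℝ (fun y => metric Φ y i j) x := fun i j =>
    differentiableAt_of_contDiffOn (h.smooth_metric i j) (by simp) hx
  have hs := differentiableAt_of_contDiffOn h.smooth_sqrtg (by simp) hx
  have h1 : pd l (fun y => sqrtg Φ y * sqrtg Φ y) x = pd l (fun y =>
      metric Φ y 0 0 * metric Φ y 1 1 - metric Φ y 0 1 * metric Φ y 0 1) x :=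
    pd_congr (fun y hy => by rw [← pow_two, ← pow_two, h.sqrtg_sq hy]) l hx
  rw [pd_mul hs hs, pd_sub ((hd 0 0).fun_mul (hd 1 1)) ((hd 0 1).fun_mul (hd 0 1)),
    pd_mul (hd 0 0) (hd 1 1), pd_mul (hd 0 1) (hd 0 1)] at h1
  linarith

theorem pd_densInv_mul_sqrtg (l i j : Fin 2) : pd l (densInv Φ i j) x * sqrtg Φ x
      + densInv Φ i j x * pd l (sqrtg Φ) x
    = pd l (fun y => densInv Φ i j y * sqrtg Φ y) x := by
  rw [pd_mul (differentiableAt_of_contDiffOn (h.smooth_densInv i j) (by simp) hx)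
    (differentiableAt_of_contDiffOn h.smooth_sqrtg (by simp) hx)]

theorem pd_densInv (l : Fin 2) :
    pd l (densInv Φ 0 0) x * sqrtg Φ x + densInv Φ 0 0 x * pd l (sqrtg Φ) x
      = pd l (fun y => metric Φ y 1 1) x ∧
    pd l (densInv Φ 0 1) x * sqrtg Φ x + densInv Φ 0 1 x * pd l (sqrtg Φ) x
      = - pd l (fun y => metric Φ y 0 1) x ∧
    pd l (densInv Φ 1 0) x * sqrtg Φ x + densInv Φ 1 0 x * pd l (sqrtg Φ) x
      = - pd l (fun y => metric Φ y 0 1) x ∧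
    pd l (densInv Φ 1 1) x * sqrtg Φ x + densInv Φ 1 1 x * pd l (sqrtg Φ) x
      = pd l (fun y => metric Φ y 0 0) x := by
  simp only [h.pd_densInv_mul_sqrtg hx, ← pd_neg]
  refine ⟨pd_congr (fun y hy => ?_) l hx, pd_congr (fun y hy => ?_) l hx,
    pd_congr (fun y hy => ?_) l hx, pd_congr (fun y hy => ?_) l hx⟩
  · rw [(h.densInv_eq hy).1, div_mul_cancel₀ _ (h.sqrtg_ne hy)]
  · rw [(h.densInv_eq hy).2.1, div_mul_cancel₀ _ (h.sqrtg_ne hy)]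
  · rw [(h.densInv_eq hy).2.2.1, div_mul_cancel₀ _ (h.sqrtg_ne hy)]
  · rw [(h.densInv_eq hy).2.2.2, div_mul_cancel₀ _ (h.sqrtg_ne hy)]

/-- `∂ₗ |g|^{1/2} = ½ |g|^{1/2} gʲᵏ ∂ₗ gⱼₖ`. -/
theorem pd_sqrtg (l : Fin 2) : pd l (sqrtg Φ) x
    = (1 / 2) * ∑ j, ∑ k, densInv Φ j k x * pd l (fun y => metric Φ y j k) x := by
  have h1 := h.two_mul_sqrtg_mul_pd_sqrtg hx l
  have hs := h.sqrtg_ne hx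
  obtain ⟨e1, e2, e3, e4⟩ := h.densInv_eq hx
  simp only [Fin.sum_univ_two, e1, e2, e3, e4, metric_symm _ 1 0]
  field_simp
  linarith

end IsImmersion

end Metric

/-! ### The second fundamental form -/

section SecondFF

variable {m : ℕ} {Φ : Plane → Amb m}

theorem normalProj_add (x : Plane) (v w : Amb m) :
    normalProj Φ x (v + w) = normalProj Φ x v + normalProj Φ x w := by
  simp only [normalProj, inner_add_left, mul_add, add_smul, Finset.sum_add_distrib]
  abel

theorem normalProj_smul (x : Plane) (c : ℝ) (v : Amb m) :
    normalProj Φ x (c • v) = c • normalProj Φ x v := by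
  simp only [normalProj, real_inner_smul_left, smul_sub, Finset.smul_sum, smul_smul]
  congr 1
  refine Finset.sum_congr rfl fun i _ => Finset.sum_congr rfl fun j _ => ?_
  congr 1
  ring

theorem normalProj_of_normal {x : Plane} {v : Amb m} (hv : ∀ l, ⟪v, pd l Φ x⟫ = 0) :
    normalProj Φ x v = v := by
  simp [normalProj, hv]

/-- The coefficients `H · hⱼₖ = H · ∂ⱼ∂ₖΦ`. -/
def meanCurvFF (Φ : Plane → Amb m) (j k : Fin 2) (x : Plane) : ℝ :=
  ⟪meanCurv Φ x, pd j (pd k Φ) x⟫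

namespace IsImmersion

variable (h : IsImmersion Φ) {x : Plane} (hx : x ∈ disk)

include h

theorem smooth_christoffel (k i j : Fin 2) : ContDiffOn ℝ ∞ (christoffel Φ k i j) disk :=
  contDiffOn_const.mul (ContDiffOn.sum fun l _ => (h.smooth_metricInv k l).mul
    (((WillmoreSystem.smooth_pd (h.smooth_metric j l) i).add
      (WillmoreSystem.smooth_pd (h.smooth_metric i l) j)).sub
      (WillmoreSystem.smooth_pd (h.smooth_metric i j) l)))

theorem smooth_secondFF (i j : Fin 2) : ContDiffOn ℝ ∞ (secondFF Φ i j) disk :=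
  (h.smooth_pd_pd i j).sub
    (ContDiffOn.sum fun k _ => (h.smooth_christoffel k i j).smul (h.smooth_pd k))

theorem smooth_meanCurv : ContDiffOn ℝ ∞ (meanCurv Φ) disk := by
  unfold meanCurv
  refine contDiffOn_const.fun_smul (ContDiffOn.sum fun i _ => ContDiffOn.sum fun j _ => ?_)
  exact (h.smooth_metricInv i j).smul (h.smooth_secondFF i j)

theorem smooth_meanCurvFF (j k : Fin 2) : ContDiffOn ℝ ∞ (meanCurvFF Φ j k) disk :=
  h.smooth_meanCurv.inner ℝ (h.smooth_pd_pd j k)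

theorem smooth_normalProj {v : Plane → Amb m} (hv : ContDiffOn ℝ ∞ v disk) :
    ContDiffOn ℝ ∞ (fun y => normalProj Φ y (v y)) disk :=
  hv.sub (ContDiffOn.sum fun i _ => ContDiffOn.sum fun j _ =>
    ((h.smooth_metricInv i j).mul (hv.inner ℝ (h.smooth_pd i))).smul (h.smooth_pd j))

include hx

theorem inner_normalProj (v : Amb m) (l : Fin 2) : ⟪normalProj Φ x v, pd l Φ x⟫ = 0 := by
  have h1 : ∀ i, ∑ j, metricInv Φ x i j * ⟪v, pd i Φ x⟫ * ⟪pd j Φ x, pd l Φ x⟫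
      = if i = l then ⟪v, pd i Φ x⟫ else 0 := by
    intro i
    have := h.metricInv_mul hx i l
    calc _ = ⟪v, pd i Φ x⟫ * ∑ j, metricInv Φ x i j * metric Φ x j l := by
          rw [Finset.mul_sum]
          refine Finset.sum_congr rfl fun j _ => ?_
          simp only [metric, Matrix.of_apply]
          ring
      _ = _ := by rw [this]; simp
  simp only [normalProj, inner_sub_left, sum_inner, real_inner_smul_left, h1]
  simp

theorem normalProj_pd (l : Fin 2) : normalProj Φ x (pd l Φ x) = 0 := by
  have h1 : ∀ j, ∑ i, metricInv Φ x i j * ⟪pd l Φ x, pd i Φ x⟫ = if j = l then 1 else 0 := by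
    intro j
    rw [← h.metricInv_mul hx j l]
    refine Finset.sum_congr rfl fun i _ => ?_
    rw [metricInv_symm, real_inner_comm]
    rfl
  rw [normalProj, Finset.sum_comm]
  simp only [← Finset.sum_smul, h1]
  simp

-- Used to check a vector identity separately on its tangential and normal parts.
omit h hx in
theorem eq_zero_of_inner_of_normalProj {v : Amb m} (h1 : ∀ l, ⟪v, pd l Φ x⟫ = 0)
    (h2 : normalProj Φ x v = 0) : v = 0 := by
  rw [← normalProj_of_normal h1, h2]

/-- Koszul's formula: the three metric derivatives expand by the product rule, and symmetry of
second derivatives leaves one term. It is what makes `secondFF` normal. -/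
theorem christoffel_lower (i j l : Fin 2) :
    ∑ k, christoffel Φ k i j x * metric Φ x k l = ⟪pd i (pd j Φ) x, pd l Φ x⟫ := by
  have h1 : ∀ a, ∑ k, metricInv Φ x k a * metric Φ x k l = if a = l then 1 else 0 := by
    intro a
    rw [← h.metricInv_mul hx a l]
    exact Finset.sum_congr rfl fun k _ => by rw [metricInv_symm]
  have h2 : ∑ k, christoffel Φ k i j x * metric Φ x k l
      = (1 / 2) * ∑ a, (∑ k, metricInv Φ x k a * metric Φ x k l) *
        (pd i (fun y => metric Φ y j a) x + pd j (fun y => metric Φ y i a) x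
          - pd a (fun y => metric Φ y i j) x) := by
    simp only [christoffel, Fin.sum_univ_two]
    ring
  rw [h2]
  simp only [h1, ite_mul, one_mul, zero_mul, Finset.sum_ite_eq', Finset.mem_univ, if_true,
    h.pd_metric hx]
  rw [h.pd_comm hx j i, h.pd_comm hx l i, h.pd_comm hx l j,
    real_inner_comm (pd j Φ x) (pd i (pd l Φ) x)]
  ring

theorem inner_secondFF (i j l : Fin 2) : ⟪secondFF Φ i j x, pd l Φ x⟫ = 0 := by
  rw [secondFF, inner_sub_left, sum_inner, ← h.christoffel_lower hx i j l, sub_eq_zero]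
  refine Finset.sum_congr rfl fun k _ => ?_
  rw [real_inner_smul_left]
  rfl

theorem normalProj_pd_pd (i j : Fin 2) : normalProj Φ x (pd i (pd j Φ) x) = secondFF Φ i j x := by
  have h1 : pd i (pd j Φ) x = secondFF Φ i j x + ∑ k, christoffel Φ k i j x • pd k Φ x := by
    simp [secondFF]
  rw [h1, normalProj_add, normalProj_of_normal (h.inner_secondFF hx i j)]
  simp [Fin.sum_univ_two, normalProj_add, normalProj_smul, h.normalProj_pd hx]

theorem secondFF_symm (i j : Fin 2) : secondFF Φ i j x = secondFF Φ j i x := by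
  rw [← h.normalProj_pd_pd hx, h.pd_comm hx, h.normalProj_pd_pd hx]

theorem inner_meanCurv (l : Fin 2) : ⟪meanCurv Φ x, pd l Φ x⟫ = 0 := by
  rw [meanCurv, real_inner_smul_left]
  simp only [sum_inner, real_inner_smul_left, h.inner_secondFF hx]
  simp

theorem meanCurvFF_symm (j k : Fin 2) : meanCurvFF Φ j k x = meanCurvFF Φ k j x := by
  rw [meanCurvFF, h.pd_comm hx, meanCurvFF]

theorem inner_secondFF_meanCurv (j k : Fin 2) :
    ⟪secondFF Φ j k x, meanCurv Φ x⟫ = meanCurvFF Φ j k x := by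
  rw [secondFF, inner_sub_left, sum_inner, meanCurvFF, real_inner_comm]
  simp [real_inner_smul_left, real_inner_comm _ (pd _ Φ x), h.inner_meanCurv hx]

/-- Differentiate H · ∂ₗΦ = 0. -/
theorem inner_pd_meanCurv (k l : Fin 2) :
    ⟪pd k (meanCurv Φ) x, pd l Φ x⟫ = - meanCurvFF Φ k l x := by
  have h1 := pd_inner (differentiableAt_of_contDiffOn h.smooth_meanCurv (by simp) hx)
    (differentiableAt_of_contDiffOn (h.smooth_pd l) (by simp) hx) k
  have h2 : pd k (fun y => ⟪meanCurv Φ y, pd l Φ y⟫) x = pd k (fun _ => (0 : ℝ)) x :=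
    pd_congr (fun y hy => h.inner_meanCurv hy l) k hx
  have h3 : pd k (fun _ => (0 : ℝ)) x = 0 := by simp [pd]
  rw [h2, h3] at h1
  rw [meanCurvFF]
  linarith

theorem trace_meanCurvFF :
    ∑ j, ∑ k, metricInv Φ x j k * meanCurvFF Φ j k x = 2 * ⟪meanCurv Φ x, meanCurv Φ x⟫ := by
  have h1 : ⟪meanCurv Φ x, meanCurv Φ x⟫ = ⟪(1 / 2 : ℝ) • ∑ i, ∑ j,
      metricInv Φ x i j • secondFF Φ i j x, meanCurv Φ x⟫ := rfl
  rw [h1]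
  simp only [real_inner_smul_left, sum_inner, h.inner_secondFF_meanCurv hx]
  ring

theorem inner_gradDens_pd (j l : Fin 2) :
    ⟪gradDens Φ Φ j x, pd l Φ x⟫ = if j = l then sqrtg Φ x else 0 := by
  rw [← h.densInv_mul hx j l, gradDens, sum_inner]
  exact Finset.sum_congr rfl fun k _ => real_inner_smul_left _ _ _

theorem pd_gradDens {F : Type*} [NormedAddCommGroup F] [NormedSpace ℝ F] {f : Plane → F}
    (hf : ∀ k, DifferentiableAt ℝ (pd k f) x) (l j : Fin 2) :
    pd l (gradDens Φ f j) x
      = ∑ k, (pd l (densInv Φ j k) x • pd k f x + densInv Φ j k x • pd l (pd k f) x) := by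
  have hD : ∀ i j, DifferentiableAt ℝ (densInv Φ i j) x := fun i j =>
    differentiableAt_of_contDiffOn (h.smooth_densInv i j) (by simp) hx
  have h1 : gradDens Φ f j = fun y => densInv Φ j 0 y • pd 0 f y + densInv Φ j 1 y • pd 1 f y := by
    funext y; simp [gradDens, Fin.sum_univ_two]
  rw [h1, pd_add ((hD j 0).fun_smul (hf 0)) ((hD j 1).fun_smul (hf 1)), pd_smul (hD j 0) (hf 0),
    pd_smul (hD j 1) (hf 1), Fin.sum_univ_two]

/-- `Δ_g Φ = 2 H`. -/
theorem div_gradDens :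
    ∑ j, pd j (gradDens Φ Φ j) x = (2 * sqrtg Φ x) • meanCurv Φ x := by
  have hp : ∀ k, DifferentiableAt ℝ (pd k Φ) x := fun k =>
    differentiableAt_of_contDiffOn (h.smooth_pd k) (by simp) hx
  have hn : normalProj Φ x (meanCurv Φ x) = meanCurv Φ x :=
    normalProj_of_normal (h.inner_meanCurv hx)
  rw [← sub_eq_zero]
  refine eq_zero_of_inner_of_normalProj (x := x) (Φ := Φ) (fun l => ?_) ?_
  -- Tangential part: differentiating ∇ʲΦ · ∂ₗΦ = δʲₗ |g|^{1/2} leaves two terms that cancel by the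
  -- formula for ∂ₗ|g|^{1/2}.
  · have h1 : ∀ j, ⟪pd j (gradDens Φ Φ j) x, pd l Φ x⟫
        = (if j = l then pd l (sqrtg Φ) x else 0)
          - ∑ k, densInv Φ j k x * ⟪pd k Φ x, pd l (pd j Φ) x⟫ := by
      intro j
      have e1 := pd_inner (differentiableAt_of_contDiffOn (h.smooth_gradDens h.smooth j)
        (by simp) hx) (hp l) j
      have e2 : pd j (fun y => ⟪gradDens Φ Φ j y, pd l Φ y⟫) x
          = if j = l then pd l (sqrtg Φ) x else 0 := by
        rw [pd_congr (fun y hy => h.inner_gradDens_pd hy j l) j hx]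
        split_ifs with hjl
        · rw [hjl]
        · simp [pd]
      have e3 : ⟪gradDens Φ Φ j x, pd j (pd l Φ) x⟫
          = ∑ k, densInv Φ j k x * ⟪pd k Φ x, pd l (pd j Φ) x⟫ := by
        rw [gradDens, sum_inner, h.pd_comm hx j l]
        exact Finset.sum_congr rfl fun k _ => real_inner_smul_left _ _ _
      rw [e2, e3] at e1
      linarith
    rw [inner_sub_left, sum_inner, real_inner_smul_left, h.inner_meanCurv hx]
    simp only [h1, Finset.sum_sub_distrib, Finset.sum_ite_eq', Finset.mem_univ, if_true]
    rw [h.pd_sqrtg hx]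
    simp only [Fin.sum_univ_two, h.pd_metric hx, densInv_symm x 1 0,
      real_inner_comm (pd _ Φ x) (pd _ (pd _ Φ) x)]
    ring
  -- Normal part: only |g|^{1/2} gʲᵏ hⱼₖ survives the projection.
  · rw [sub_eq_add_neg, ← neg_one_smul ℝ, normalProj_add, normalProj_smul, normalProj_smul, hn]
    simp only [h.pd_gradDens hx hp, Fin.sum_univ_two, normalProj_add, normalProj_smul,
      h.normalProj_pd hx, h.normalProj_pd_pd hx, meanCurv, densInv]
    module

end IsImmersion

end SecondFF

/-! ### The conservation law for the Willmore operator -/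

section Conservation

variable {m : ℕ} {Φ : Plane → Amb m}

/-- The densitized normal gradient `|g|^{1/2} π_n ∇ʲ H`. -/
def normalFlux (Φ : Plane → Amb m) (j : Fin 2) (x : Plane) : Amb m :=
  sqrtg Φ x • normalProj Φ x (gradUp Φ (meanCurv Φ) j x)

/-- The coefficients `|g|^{1/2} (H · hʲᵇ - |H|² gʲᵇ)`. -/
def stressCoeff (Φ : Plane → Amb m) (j b : Fin 2) (x : Plane) : ℝ :=
  (∑ k, ∑ a, densInv Φ j k x * metricInv Φ x a b * meanCurvFF Φ k a x)
    - ⟪meanCurv Φ x, meanCurv Φ x⟫ * densInv Φ j b x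

/-- The densitized stress `|g|^{1/2} (∇ʲ H - 2 π_n ∇ʲ H + |H|² ∇ʲ Φ)`, decomposed into its normal
and tangential parts. -/
def stress (Φ : Plane → Amb m) (j : Fin 2) (x : Plane) : Amb m :=
  - normalFlux Φ j x - ∑ b, stressCoeff Φ j b x • pd b Φ x

namespace IsImmersion

variable (h : IsImmersion Φ) {x : Plane} (hx : x ∈ disk)

include h

theorem smooth_normalFlux (j : Fin 2) : ContDiffOn ℝ ∞ (normalFlux Φ j) disk := by
  refine h.smooth_sqrtg.smul (h.smooth_normalProj ?_)
  exact ContDiffOn.sum fun k _ => (h.smooth_metricInv j k).smul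
    (WillmoreSystem.smooth_pd h.smooth_meanCurv k)

theorem smooth_stressCoeff (j b : Fin 2) : ContDiffOn ℝ ∞ (stressCoeff Φ j b) disk :=
  (ContDiffOn.sum fun k _ => ContDiffOn.sum fun a _ =>
    ((h.smooth_densInv j k).mul (h.smooth_metricInv a b)).mul (h.smooth_meanCurvFF k a)).sub
    ((h.smooth_meanCurv.inner ℝ h.smooth_meanCurv).mul (h.smooth_densInv j b))

theorem smooth_stress (j : Fin 2) : ContDiffOn ℝ ∞ (stress Φ j) disk :=
  (h.smooth_normalFlux j).neg.sub
    (ContDiffOn.sum fun b _ => (h.smooth_stressCoeff j b).smul (h.smooth_pd b))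

include hx

theorem inner_gradDens_meanCurv (j a : Fin 2) : ⟪gradDens Φ (meanCurv Φ) j x, pd a Φ x⟫
    = - ∑ k, densInv Φ j k x * meanCurvFF Φ k a x := by
  simp only [gradDens, sum_inner, real_inner_smul_left, h.inner_pd_meanCurv hx, mul_neg,
    Finset.sum_neg_distrib]

/-- Weingarten's relation: the tangential part of ∇H is determined by H · h. -/
theorem gradDens_meanCurv (j : Fin 2) : gradDens Φ (meanCurv Φ) j x
    = normalFlux Φ j x - ∑ k, ∑ a, ∑ b,
        (densInv Φ j k x * metricInv Φ x a b * meanCurvFF Φ k a x) • pd b Φ x := by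
  have h1 : normalFlux Φ j x = normalProj Φ x (gradDens Φ (meanCurv Φ) j x) := by
    rw [normalFlux, ← normalProj_smul, sqrtg_smul_gradUp]
  rw [h1, normalProj]
  simp only [h.inner_gradDens_meanCurv hx, Fin.sum_univ_two]
  module

theorem inner_normalFlux (j l : Fin 2) : ⟪normalFlux Φ j x, pd l Φ x⟫ = 0 := by
  rw [normalFlux, real_inner_smul_left, h.inner_normalProj hx, mul_zero]

theorem meanCurv_inner_pd_gradDens (l j : Fin 2) :
    ⟪meanCurv Φ x, pd l (gradDens Φ Φ j) x⟫ = ∑ k, densInv Φ j k x * meanCurvFF Φ k l x := by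
  rw [h.pd_gradDens hx (fun k => differentiableAt_of_contDiffOn (h.smooth_pd k) (by simp) hx)]
  simp only [inner_sum, inner_add_right, real_inner_smul_right, h.inner_meanCurv hx, mul_zero,
    zero_add]
  exact Finset.sum_congr rfl fun k _ => by rw [h.meanCurvFF_symm hx k l, meanCurvFF]

/-- The tangential components of T are written through ∂ₗ∇ʲΦ so that a later ∂ⱼ can be commuted past
∂ₗ and summed into ∂ₗ(2|g|^{1/2}H). This replaces the Codazzi equation. -/
theorem inner_stress (j l : Fin 2) : ⟪stress Φ j x, pd l Φ x⟫
    = - ⟪meanCurv Φ x, pd l (gradDens Φ Φ j) x⟫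
      + if j = l then sqrtg Φ x * ⟪meanCurv Φ x, meanCurv Φ x⟫ else 0 := by
  have h1 := h.densInv_mul hx j l
  have h2 : ∀ a, ∑ b, metricInv Φ x a b * metric Φ x b l = if a = l then 1 else 0 :=
    fun a => h.metricInv_mul hx a l
  have h3 : ⟪stress Φ j x, pd l Φ x⟫ = - (∑ k, ∑ a, densInv Φ j k x * meanCurvFF Φ k a x *
      ∑ b, metricInv Φ x a b * metric Φ x b l)
      + ⟪meanCurv Φ x, meanCurv Φ x⟫ * ∑ b, densInv Φ j b x * metric Φ x b l := by
    rw [stress, inner_sub_left, inner_neg_left, h.inner_normalFlux hx, sum_inner]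
    simp only [real_inner_smul_left, stressCoeff, Fin.sum_univ_two, metric, Matrix.of_apply]
    ring
  rw [h3, h1, h.meanCurv_inner_pd_gradDens hx]
  simp only [h2, mul_ite, mul_one, mul_zero, Finset.sum_ite_eq', Finset.mem_univ, if_true]
  rw [mul_comm (sqrtg Φ x)]

/-- This is ∂ₗ(|g|^{1/2}gʲᵏ) = gʲᵏ ∂ₗ|g|^{1/2} - |g|^{1/2} gʲᵃgᵏᵇ ∂ₗgₐᵦ contracted with the
symmetric form H · h, whose trace is 2|H|². -/
theorem sum_pd_densInv_mul_meanCurvFF (l : Fin 2) :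
    ∑ j, ∑ k, pd l (densInv Φ j k) x * meanCurvFF Φ j k x
      + ∑ j, ∑ k, ∑ a, ∑ b, densInv Φ j k x * metricInv Φ x a b * meanCurvFF Φ k a x
          * pd l (fun y => metric Φ y b j) x
      - 2 * ⟪meanCurv Φ x, meanCurv Φ x⟫ * pd l (sqrtg Φ) x = 0 := by
  have hs := h.sqrtg_ne hx
  have hs2 := h.sqrtg_sq hx
  have hds := h.two_mul_sqrtg_mul_pd_sqrtg hx l
  have hA := h.meanCurvFF_symm hx 1 0
  have htr := h.trace_meanCurvFF hx
  obtain ⟨d1, d2, d3, d4⟩ := h.pd_densInv hx l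
  obtain ⟨e1, e2, e3, e4⟩ := h.densInv_eq hx
  obtain ⟨g1, g2, g3, g4⟩ := h.metricInv_eq hx
  rw [← eq_sub_iff_add_eq, ← eq_div_iff hs] at d1 d2 d3 d4
  rw [← htr]
  simp only [Fin.sum_univ_two, d1, d2, d3, d4, e1, e2, e3, e4, g1, g2, g3, g4, hA,
    metric_symm _ 1 0]
  generalize pd l (sqrtg Φ) x = ds at *
  generalize pd l (fun y => metric Φ y 0 0) x = dE at *
  generalize pd l (fun y => metric Φ y 0 1) x = dF at *
  generalize pd l (fun y => metric Φ y 1 1) x = dG at *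
  generalize metric Φ x 0 0 = E at *
  generalize metric Φ x 0 1 = F at *
  generalize metric Φ x 1 1 = G at *
  generalize meanCurvFF Φ 0 0 x = a at *
  generalize meanCurvFF Φ 0 1 x = b at *
  generalize meanCurvFF Φ 1 1 x = c at *
  generalize sqrtg Φ x = s at *
  clear d1 d2 d3 d4 e1 e2 e3 e4 g1 g2 g3 g4 htr hA
  field_simp
  -- Only |g| = EG - F² and its ∂ₗ-derivative are needed; a, b, c are free.
  linear_combination (dG * a - 2 * dF * b + dE * c) * hs2 - (G * a - 2 * F * b + E * c) * hds

/-- Apply ∂ⱼ to `inner_stress` and move the derivative off ∂ₗΦ. Third derivatives of Φ occur only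
through ∂ₗ of the divergence of ∇ʲΦ, which is known; the normal fluxes of T and ∇H cancel, and the
rest is the variation of the metric along ∂ₗ. -/
theorem div_stress_inner (l : Fin 2) : ⟪∑ j, pd j (stress Φ j) x, pd l Φ x⟫ = 0 := by
  have hp : ∀ k, DifferentiableAt ℝ (pd k Φ) x := fun k =>
    differentiableAt_of_contDiffOn (h.smooth_pd k) (by simp) hx
  have hH := differentiableAt_of_contDiffOn h.smooth_meanCurv (by simp) hx
  have hs := differentiableAt_of_contDiffOn h.smooth_sqrtg (by simp) hx
  have hΨ : ∀ j, ContDiffOn ℝ ∞ (gradDens Φ Φ j) disk := h.smooth_gradDens h.smooth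
  have hΨd : ∀ j, DifferentiableAt ℝ (pd l (gradDens Φ Φ j)) x := fun j =>
    differentiableAt_of_contDiffOn (WillmoreSystem.smooth_pd (hΨ j) l) (by simp) hx
  set H2 : Plane → ℝ := fun y => ⟪meanCurv Φ y, meanCurv Φ y⟫ with hH2
  have hH2d : DifferentiableAt ℝ H2 x := hH.inner ℝ hH
  have pdH2 : pd l H2 x = 2 * ⟪meanCurv Φ x, pd l (meanCurv Φ) x⟫ := by
    rw [hH2, pd_inner hH hH, real_inner_comm]
    ring
  have h1 : ∀ j, ⟪pd j (stress Φ j) x, pd l Φ x⟫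
      = - (⟪pd j (meanCurv Φ) x, pd l (gradDens Φ Φ j) x⟫
          + ⟪meanCurv Φ x, pd l (pd j (gradDens Φ Φ j)) x⟫)
        + (if j = l then pd l (sqrtg Φ) x * H2 x + sqrtg Φ x * pd l H2 x else 0)
        - ⟪stress Φ j x, pd l (pd j Φ) x⟫ := by
    intro j
    have e1 := pd_inner (differentiableAt_of_contDiffOn (h.smooth_stress j) (by simp) hx) (hp l) j
    have e2 := pd_congr (fun y hy => h.inner_stress hy j l) j hx
    have e3 : DifferentiableAt ℝ (fun y => - ⟪meanCurv Φ y, pd l (gradDens Φ Φ j) y⟫) x :=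
      (hH.inner ℝ (hΨd j)).fun_neg
    have e4 : pd j (fun y => if j = l then sqrtg Φ y * H2 y else 0) x
        = if j = l then pd l (sqrtg Φ) x * H2 x + sqrtg Φ x * pd l H2 x else 0 := by
      split_ifs with hjl
      · rw [pd_mul hs hH2d, hjl]
      · simp [pd]
    have e5 : DifferentiableAt ℝ (fun y => if j = l then sqrtg Φ y * H2 y else 0) x := by
      split_ifs
      · exact hs.fun_mul hH2d
      · exact differentiableAt_const _
    rw [pd_add e3 e5, e4, pd_neg, pd_inner hH (hΨd j),
      WillmoreSystem.pd_comm (hΨ j) (WithTop.coe_le_coe.2 (le_top : (2 : ℕ∞) ≤ ⊤)) j l hx] at e2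
    rw [h.pd_comm hx j l, e2] at e1
    linarith
  have h2 : ∑ j, pd l (pd j (gradDens Φ Φ j)) x
      = (2 * pd l (sqrtg Φ) x) • meanCurv Φ x + (2 * sqrtg Φ x) • pd l (meanCurv Φ) x := by
    have e1 := pd_congr (fun y hy => h.div_gradDens hy) l hx
    have e2 : ∀ j, DifferentiableAt ℝ (pd j (gradDens Φ Φ j)) x := fun j =>
      differentiableAt_of_contDiffOn (WillmoreSystem.smooth_pd (hΨ j) j) (by simp) hx
    have e3 : pd l (fun y => 2 * sqrtg Φ y) x = 2 * pd l (sqrtg Φ) x := by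
      rw [pd_mul (differentiableAt_const _) hs]
      simp [pd]
    simp only [Fin.sum_univ_two] at e1 ⊢
    rw [pd_add (e2 0) (e2 1), pd_smul (hs.const_mul 2) hH, e3] at e1
    exact e1
  -- The derivative on the density meets ∂ⱼH · ∂ₖΦ = -H · hⱼₖ; the other term regroups by symmetry
  -- of the density.
  have h3 : ∑ j, ⟪pd j (meanCurv Φ) x, pd l (gradDens Φ Φ j) x⟫
      = - ∑ j, ∑ k, pd l (densInv Φ j k) x * meanCurvFF Φ j k x
        + ∑ k, ⟪gradDens Φ (meanCurv Φ) k x, pd l (pd k Φ) x⟫ := by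
    simp only [h.pd_gradDens hx hp, gradDens, Fin.sum_univ_two, inner_add_right, inner_add_left,
      real_inner_smul_right, real_inner_smul_left, h.inner_pd_meanCurv hx, densInv_symm x 1 0]
    ring
  have h4 := h.sum_pd_densInv_mul_meanCurvFF hx l
  have h5 := h.pd_sqrtg hx l
  rw [sum_inner]
  simp only [h1, Finset.sum_add_distrib, Finset.sum_sub_distrib, Finset.sum_neg_distrib,
    ← inner_sum, h2, h3, Finset.sum_ite_eq', Finset.mem_univ, if_true, pdH2, inner_add_right,
    real_inner_smul_right]
  have hg := metricInv_symm (Φ := Φ) x 1 0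
  have hD := densInv_symm (Φ := Φ) x 1 0
  have hA := h.meanCurvFF_symm hx 1 0
  simp only [h.pd_metric hx, Fin.sum_univ_two, h.gradDens_meanCurv hx, stress, stressCoeff,
    inner_add_left, inner_sub_left, inner_neg_left, real_inner_smul_left, densInv, hg, hA,
    real_inner_comm (pd _ Φ x) (pd _ (pd _ Φ) x)] at h4 h5 ⊢
  linear_combination h4 + ⟪meanCurv Φ x, meanCurv Φ x⟫ * h5

/-- The first part of the coefficient gives (hⁱⱼ · H) hʲᵢ; the multiple of the metric traces h to
2H. These are the zeroth-order terms of the Willmore operator. -/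
theorem stressCoeff_secondFF : ∑ j, ∑ b, stressCoeff Φ j b x • secondFF Φ j b x
    = sqrtg Φ x • (∑ i, ∑ j, ⟪secondFFMixed Φ i j x, meanCurv Φ x⟫ • secondFFMixed Φ j i x
      - (2 * ‖meanCurv Φ x‖ ^ 2) • meanCurv Φ x) := by
  have hh := h.secondFF_symm hx 1 0
  have hg := metricInv_symm (Φ := Φ) x 1 0
  have hA := h.meanCurvFF_symm hx 1 0
  have hH : (2 * ‖meanCurv Φ x‖ ^ 2) • meanCurv Φ x = ⟪meanCurv Φ x, meanCurv Φ x⟫ •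
      ∑ i, ∑ j, metricInv Φ x i j • secondFF Φ i j x := by
    have h2 : (2 : ℝ) • meanCurv Φ x = ∑ i, ∑ j, metricInv Φ x i j • secondFF Φ i j x := by
      rw [meanCurv, smul_smul]
      norm_num
    rw [← real_inner_self_eq_norm_sq, ← h2, smul_smul, mul_comm]
  have hM : ∀ i j, ⟪secondFFMixed Φ i j x, meanCurv Φ x⟫
      = ∑ k, metricInv Φ x i k * meanCurvFF Φ k j x := by
    intro i j
    simp only [secondFFMixed, sum_inner, real_inner_smul_left, h.inner_secondFF_meanCurv hx]
  rw [hH]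
  simp only [hM]
  simp only [secondFFMixed, stressCoeff, densInv, Fin.sum_univ_two, hh, hg, hA]
  module

/-- The conservation law `∇ⱼ (∇ʲ H - 2 π_n ∇ʲ H + |H|² ∇ʲ Φ) = - (Willmore operator)`. -/
theorem div_stress : ∑ j, pd j (stress Φ j) x = - sqrtg Φ x • willmoreOp Φ x := by
  have hp : ∀ k, DifferentiableAt ℝ (pd k Φ) x := fun k =>
    differentiableAt_of_contDiffOn (h.smooth_pd k) (by simp) hx
  have hQ : ∀ j b, DifferentiableAt ℝ (stressCoeff Φ j b) x := fun j b =>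
    differentiableAt_of_contDiffOn (h.smooth_stressCoeff j b) (by simp) hx
  have hν : ∀ j, DifferentiableAt ℝ (normalFlux Φ j) x := fun j =>
    differentiableAt_of_contDiffOn (h.smooth_normalFlux j) (by simp) hx
  have hpd : ∀ j, pd j (stress Φ j) x = - pd j (normalFlux Φ j) x
      - ∑ b, (pd j (stressCoeff Φ j b) x • pd b Φ x
        + stressCoeff Φ j b x • pd j (pd b Φ) x) := by
    intro j
    have e : stress Φ j = fun y => - normalFlux Φ j y
        - (stressCoeff Φ j 0 y • pd 0 Φ y + stressCoeff Φ j 1 y • pd 1 Φ y) := by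
      funext y; simp [stress, Fin.sum_univ_two]
    rw [e, pd_sub (hν j).fun_neg (((hQ j 0).fun_smul (hp 0)).fun_add ((hQ j 1).fun_smul (hp 1))),
      pd_neg, pd_add ((hQ j 0).fun_smul (hp 0)) ((hQ j 1).fun_smul (hp 1)),
      pd_smul (hQ j 0) (hp 0), pd_smul (hQ j 1) (hp 1), Fin.sum_univ_two]
  have hW : sqrtg Φ x • willmoreOp Φ x = normalProj Φ x (∑ j, pd j (normalFlux Φ j) x)
      + ∑ j, ∑ b, stressCoeff Φ j b x • secondFF Φ j b x := by
    rw [h.stressCoeff_secondFF hx, willmoreOp, add_sub_assoc, smul_add, normalLaplace,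
      ← normalProj_smul, h.sqrtg_smul_covDiv hx]
    rfl
  have hWn : ∀ l, ⟪sqrtg Φ x • willmoreOp Φ x, pd l Φ x⟫ = 0 := by
    intro l
    rw [hW, inner_add_left, h.inner_normalProj hx]
    simp only [sum_inner, real_inner_smul_left, h.inner_secondFF hx]
    simp
  -- The projection kills the ∂ᵦΦ produced by differentiating coefficients and turns ∂ⱼ∂ᵦΦ into hⱼᵦ.
  have hT : normalProj Φ x (∑ j, pd j (stress Φ j) x) = - sqrtg Φ x • willmoreOp Φ x := by
    rw [neg_smul, hW]
    have hneg : ∀ v : Amb m, -v = (-1 : ℝ) • v := fun v => by simp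
    simp only [hpd, Fin.sum_univ_two, sub_eq_add_neg, hneg, normalProj_add, normalProj_smul,
      h.normalProj_pd hx, h.normalProj_pd_pd hx]
    module
  rw [← hT]
  exact (normalProj_of_normal (h.div_stress_inner hx)).symm

end IsImmersion

end Conservation

/-! ### The Gauss map -/

section GaussMap

variable {m : ℕ} {Φ : Plane → Amb m}

theorem starN_eq (x : Plane) : starN Φ x = (sqrtg Φ x)⁻¹ • wedge (pd 0 Φ x) (pd 1 Φ x) := by
  simp only [starN, Fin.sum_univ_two, eps, wedge_self, wedge_swap (pd 1 Φ x) (pd 0 Φ x)]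
  simp only [Matrix.cons_val_zero, Matrix.cons_val_one]
  module

theorem contract_starN (x : Plane) (v : Amb m) : contract (starN Φ x) v
    = (sqrtg Φ x)⁻¹ • (⟪pd 0 Φ x, v⟫ • pd 1 Φ x - ⟪pd 1 Φ x, v⟫ • pd 0 Φ x) := by
  rw [starN_eq, contract_smul_left, contract_wedge]

namespace IsImmersion

variable (h : IsImmersion Φ) {x : Plane} (hx : x ∈ disk)

include h

theorem smooth_starN : ContDiffOn ℝ ∞ (starN Φ) disk :=
  ((h.smooth_sqrtg.inv fun _ hx => h.sqrtg_ne hx).smul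
    (contDiffOn_wedge (h.smooth_pd 0) (h.smooth_pd 1))).congr fun x _ => starN_eq x

include hx

/-- The inverse of a 2×2 matrix is its cofactor matrix over the determinant, so conjugating g by ε
and dividing by |g|^{1/2} yields |g|^{1/2}gʲᵏ. Only the tangential part of v is seen. -/
theorem inner_starN_wedge (v : Amb m) (j : Fin 2) :
    ∑ k, eps j k * ⟪starN Φ x, wedge v (pd k Φ x)⟫ = ∑ k, densInv Φ j k x * ⟪v, pd k Φ x⟫ := by
  obtain ⟨e1, e2, e3, e4⟩ := h.densInv_eq hx
  have hm : ∀ i j, ⟪pd i Φ x, pd j Φ x⟫ = metric Φ x i j := fun _ _ => rfl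
  simp only [starN_eq, real_inner_smul_left, inner_wedge_wedge, Fin.sum_univ_two, eps, hm,
    metric_symm x 1 0, real_inner_comm v]
  fin_cases j <;> simp [e1, e2, e3, e4] <;> ring

/-- Used with v = L and w = H. Contraction with ⋆n rotates tangent vectors and annihilates normal
ones; comparing coefficients of the wedges leaves only |g| = EG - F². -/
theorem bullet_starN_wedge {w : Amb m} (hw : ∀ l, ⟪w, pd l Φ x⟫ = 0) (v : Amb m) (j : Fin 2) :
    ∑ k, densInv Φ j k x • wedge v (pd k Φ x) + ∑ k, eps j k • wedge w (pd k Φ x)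
      = - (∑ k, eps j k • (⟪v, pd k Φ x⟫ • starN Φ x + bullet (starN Φ x) (wedge v (pd k Φ x))))
        + ∑ k, densInv Φ j k x • bullet (starN Φ x) (wedge w (pd k Φ x)) := by
  obtain ⟨e1, e2, e3, e4⟩ := h.densInv_eq hx
  have hs := h.sqrtg_ne hx
  have hs2 := h.sqrtg_sq hx
  have hm : ∀ i j, ⟪pd i Φ x, pd j Φ x⟫ = metric Φ x i j := fun _ _ => rfl
  have hw' : ∀ l, ⟪pd l Φ x, w⟫ = 0 := fun l => by rw [real_inner_comm, hw]
  simp only [bullet_wedge, contract_starN, hm, hw', Fin.sum_univ_two, zero_smul, sub_zero,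
    smul_zero, wedge_zero_left, zero_sub, wedge_smul_left, wedge_sub_left, wedge_self,
    metric_symm x 1 0, real_inner_comm v, wedge_swap (pd 1 Φ x) (pd 0 Φ x),
    wedge_swap (pd _ Φ x) v, wedge_swap (pd _ Φ x) w]
  simp only [starN_eq]
  fin_cases j
  · simp only [eps, e1, e2, Fin.zero_eta, Matrix.cons_val_zero, Matrix.cons_val_one]
    match_scalars <;> field_simp <;> first | ring1 | linear_combination hs2
  · simp only [eps, e3, e4, Fin.mk_one, Matrix.cons_val_zero, Matrix.cons_val_one]
    match_scalars <;> field_simp <;> first | ring1 | linear_combination -hs2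

/-- Dilation invariance: the trace is -H · 2|g|^{1/2}H plus 2|g|^{1/2}|H|², the last 2 being the
dimension of the disk. -/
theorem sum_inner_stress : ∑ j, ⟪stress Φ j x, pd j Φ x⟫ = 0 := by
  have h1 := congrArg (fun v => ⟪meanCurv Φ x, v⟫) (h.div_gradDens hx)
  simp only [h.inner_stress hx, Fin.sum_univ_two, inner_add_right, real_inner_smul_right,
    if_true] at h1 ⊢
  linarith

/-- Rotation invariance. The tangential coefficients of T are symmetric and drop out of the wedge;
the normal flux of T cancels that of ∇H, which comes from differentiating H ∧ ∇ʲΦ. -/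
theorem sum_wedge_stress : ∑ j, wedge (stress Φ j x) (pd j Φ x)
    + ∑ j, pd j (fun y => wedge (meanCurv Φ y) (gradDens Φ Φ j y)) x = 0 := by
  have hH := differentiableAt_of_contDiffOn h.smooth_meanCurv (by simp) hx
  have hΨ : ∀ j, DifferentiableAt ℝ (gradDens Φ Φ j) x := fun j =>
    differentiableAt_of_contDiffOn (h.smooth_gradDens h.smooth j) (by simp) hx
  have h1 : ∑ j, wedge (meanCurv Φ x) (pd j (gradDens Φ Φ j) x) = 0 := by
    simp only [← wedgeₗ_apply, ← map_sum, h.div_gradDens hx]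
    simp [wedgeₗ_apply]
  have h2 : ∑ j, wedge (pd j (meanCurv Φ) x) (gradDens Φ Φ j x)
      = ∑ j, wedge (gradDens Φ (meanCurv Φ) j x) (pd j Φ x) := by
    simp only [gradDens, Fin.sum_univ_two, wedge_add_left, wedge_add_right, wedge_smul_left,
      wedge_smul_right, densInv_symm x 1 0]
    module
  simp only [pd_wedge hH (hΨ _), Finset.sum_add_distrib, h1, h2, add_zero]
  have hA := h.meanCurvFF_symm hx 1 0
  have hg := metricInv_symm (Φ := Φ) x 1 0
  simp only [h.gradDens_meanCurv hx, stress, stressCoeff, Fin.sum_univ_two, wedge_add_left,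
    wedge_sub_left, wedge_neg_left, wedge_smul_left, wedge_self, densInv, hA, hg,
    wedge_swap (pd 1 Φ x) (pd 0 Φ x)]
  module

end IsImmersion

end GaussMap

/-! ### Rotated gradients -/

section Rotated

variable {E F G : Type*} [NormedAddCommGroup E] [NormedSpace ℝ E]
  [NormedAddCommGroup F] [NormedSpace ℝ F] [NormedAddCommGroup G] [NormedSpace ℝ G]

/-- The field `εʲᵏ B(f, ∂ₖ u)`. -/
def rotProd (B : E →L[ℝ] F →L[ℝ] G) (f : Plane → E) (u : Plane → F) (j : Fin 2) (x : Plane) : G :=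
  ∑ k, eps j k • B (f x) (pd k u x)

theorem contDiffOn_rotProd (B : E →L[ℝ] F →L[ℝ] G) {f : Plane → E} {u : Plane → F} {q : ℕ∞}
    (hf : ContDiffOn ℝ q f disk) (hu : ContDiffOn ℝ (q + 1 : ℕ∞) u disk) (j : Fin 2) :
    ContDiffOn ℝ q (rotProd B f u j) disk :=
  ContDiffOn.sum fun k _ => contDiffOn_const.smul
    (contDiffOn_bilin B hf (contDiffOn_pd hu (by exact_mod_cast le_rfl) k))

/-- The second derivatives of u cancel against the antisymmetric ε, leaving a Jacobian expression.
-/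
theorem div_rotProd (B : E →L[ℝ] F →L[ℝ] G) {f : Plane → E} {u : Plane → F} {n : WithTop ℕ∞}
    {x : Plane} (hx : x ∈ disk) (hf : DifferentiableAt ℝ f x) (hu : ContDiffOn ℝ n u disk)
    (hn : 2 ≤ n) :
    ∑ j, pd j (rotProd B f u j) x = ∑ j, ∑ k, eps j k • B (pd j f x) (pd k u x) := by
  have hd : ∀ k, DifferentiableAt ℝ (pd k u) x := fun k =>
    differentiableAt_of_contDiffOn
      (contDiffOn_pd hu (k := 1) (by rwa [one_add_one_eq_two]) k) one_ne_zero hx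
  have h0 : rotProd B f u 0 = fun y => B (f y) (pd 1 u y) := by
    funext y; simp [rotProd, eps]
  have h1 : rotProd B f u 1 = fun y => - B (f y) (pd 0 u y) := by
    funext y; simp [rotProd, eps]
  rw [Fin.sum_univ_two, h0, h1, pd_neg, pd_bilin B hf (hd 1), pd_bilin B hf (hd 0),
    pd_comm hu hn 0 1 hx]
  simp [eps]

/-- The field `εʲᵏ ∂ₖ u`. -/
def rotGrad (u : Plane → F) (j : Fin 2) (x : Plane) : F :=
  ∑ k, eps j k • pd k u x

theorem contDiffOn_rotGrad {u : Plane → F} {q : ℕ∞} (hu : ContDiffOn ℝ (q + 1 : ℕ∞) u disk)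
    (j : Fin 2) : ContDiffOn ℝ q (rotGrad u j) disk :=
  ContDiffOn.sum fun k _ => contDiffOn_const.smul
    (contDiffOn_pd hu (by exact_mod_cast le_rfl) k)

theorem div_rotGrad {u : Plane → F} {n : WithTop ℕ∞} {x : Plane} (hx : x ∈ disk)
    (hu : ContDiffOn ℝ n u disk) (hn : 2 ≤ n) : ∑ j, pd j (rotGrad u j) x = 0 := by
  have h1 : rotGrad u = rotProd (ContinuousLinearMap.lsmul ℝ ℝ) (fun _ => (1 : ℝ)) u := by
    funext j y
    simp [rotGrad, rotProd]
  rw [h1, div_rotProd _ hx (differentiableAt_const _) hu hn]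
  simp [pd]

end Rotated

/-! ### The potentials -/

section Potentials

variable {m : ℕ} {Φ : Plane → Amb m}

theorem contract_neg_left (α : BiVec m) (v : Amb m) : contract (-α) v = - contract α v := by
  simp [← contractL_apply]

theorem bullet_neg_right (α β : BiVec m) : bullet α (-β) = - bullet α β := by
  simp [← bulletL_apply]

theorem two_le_coe_add_one {q : ℕ∞} (hq : 1 ≤ q) : (2 : WithTop ℕ∞) ≤ (q + 1 : ℕ∞) := by
  have h : (2 : ℕ∞) ≤ q + 1 := by
    rw [← one_add_one_eq_two]
    gcongr
  exact WithTop.coe_le_coe.2 h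

theorem differentiableAt_of_one_le {F : Type*} [NormedAddCommGroup F] [NormedSpace ℝ F] {q : ℕ∞}
    (hq : 1 ≤ q) {f : Plane → F} (hf : ContDiffOn ℝ q f disk) {x : Plane} (hx : x ∈ disk) :
    DifferentiableAt ℝ f x :=
  differentiableAt_of_contDiffOn (hf.of_le (m := 1) (WithTop.coe_le_coe.2 hq)) one_ne_zero hx

namespace IsImmersion

variable (h : IsImmersion Φ)

include h

theorem sum_inner_gradDens {V : Plane → Amb m} {Y : Plane → ℝ} {x : Plane} (hx : x ∈ disk)
    (hY : laplace Φ Y x = ∑ j, inner ℝ (gradUp Φ V j x) (pd j Φ x)) :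
    ∑ j, pd j (gradDens Φ Y j) x = ∑ j, ⟪gradDens Φ V j x, pd j Φ x⟫ := by
  rw [← h.sqrtg_smul_laplace hx, hY, Finset.smul_sum]
  simp only [← sqrtg_smul_gradUp, real_inner_smul_left, smul_eq_mul]

theorem sum_wedge_gradDens {V : Plane → Amb m} {X : Plane → BiVec m} {x : Plane} (hx : x ∈ disk)
    (hX : laplace Φ X x = ∑ j, wedge (gradUp Φ V j x) (pd j Φ x)) :
    ∑ j, pd j (gradDens Φ X j) x = ∑ j, wedge (gradDens Φ V j x) (pd j Φ x) := by
  rw [← h.sqrtg_smul_laplace hx, hX, Finset.smul_sum]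
  simp only [← sqrtg_smul_gradUp, wedge_smul_left]

/-- The potential `L` with `εʲᵏ ∂ₖ L = |g|^{1/2} (Tʲ - ∇ʲ V)`, where `T` is the stress. -/
theorem exists_stress_potential {q : ℕ∞} (hq : 1 ≤ q) {V : Plane → Amb m}
    (hVr : ContDiffOn ℝ (q + 1 : ℕ∞) V disk)
    (hV : ∀ x ∈ disk, laplace Φ V x = - willmoreOp Φ x) :
    ∃ L : Plane → Amb m, ContDiffOn ℝ (q + 1 : ℕ∞) L disk ∧ ∀ x ∈ disk,
      pd 0 L x = gradDens Φ V 1 x - stress Φ 1 x ∧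
      pd 1 L x = stress Φ 0 x - gradDens Φ V 0 x := by
  have hV' : ∀ j, ContDiffOn ℝ q (gradDens Φ V j) disk := h.contDiffOn_gradDens hVr le_rfl
  have hT : ∀ j, ContDiffOn ℝ q (stress Φ j) disk := fun j =>
    (h.smooth_stress j).of_le (WithTop.coe_le_coe.2 le_top)
  obtain ⟨L, hL, hLpd⟩ := exists_potential hq
    ![fun y => gradDens Φ V 1 y - stress Φ 1 y, fun y => stress Φ 0 y - gradDens Φ V 0 y]
    (fun j => by
      fin_cases j
      · exact (hV' 1).sub (hT 1)
      · exact (hT 0).sub (hV' 0))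
    (fun x hx => by
      have hd : ∀ j, DifferentiableAt ℝ (gradDens Φ V j) x := fun j =>
        differentiableAt_of_one_le hq (hV' j) hx
      have hd' : ∀ j, DifferentiableAt ℝ (stress Φ j) x := fun j =>
        differentiableAt_of_one_le hq (hT j) hx
      have h1 := h.sqrtg_smul_laplace hx V
      have h2 := h.div_stress hx
      rw [hV x hx, smul_neg, ← neg_smul, ← h2, Fin.sum_univ_two, Fin.sum_univ_two] at h1
      simp only [Matrix.cons_val_zero, Matrix.cons_val_one]
      rw [pd_sub (hd' 0) (hd 0), pd_sub (hd 1) (hd' 1), sub_eq_sub_iff_add_eq_add, h1, add_comm])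
  exact ⟨L, hL, fun x hx => ⟨hLpd x hx 0, hLpd x hx 1⟩⟩

variable {q : ℕ∞} (hq : 1 ≤ q) {V L : Plane → Amb m}
  (hL : ContDiffOn ℝ (q + 1 : ℕ∞) L disk)
  (hLpd : ∀ x ∈ disk, pd 0 L x = gradDens Φ V 1 x - stress Φ 1 x ∧
    pd 1 L x = stress Φ 0 x - gradDens Φ V 0 x)

include hq hL hLpd

/-- The curl of L · ∂ᵢΦ is (∇ʲV - Tʲ) · ∂ⱼΦ: T drops out by dilation invariance, and the rotated ∇Y
compensates the rest. -/
theorem exists_scalar_potential {Y : Plane → ℝ} (hYr : ContDiffOn ℝ (q + 1 : ℕ∞) Y disk)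
    (hY : ∀ x ∈ disk, laplace Φ Y x = ∑ j, inner ℝ (gradUp Φ V j x) (pd j Φ x)) :
    ∃ S : Plane → ℝ, ContDiffOn ℝ (q + 1 : ℕ∞) S disk ∧ ∀ x ∈ disk,
      pd 0 S x = ⟪L x, pd 0 Φ x⟫ + gradDens Φ Y 1 x ∧
      pd 1 S x = ⟪L x, pd 1 Φ x⟫ - gradDens Φ Y 0 x := by
  have hY' : ∀ j, ContDiffOn ℝ q (gradDens Φ Y j) disk := h.contDiffOn_gradDens hYr le_rfl
  have hLq : ContDiffOn ℝ q L disk := hL.of_le (WithTop.coe_le_coe.2 le_self_add)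
  have hp : ∀ j, ContDiffOn ℝ q (pd j Φ) disk := fun j =>
    (h.smooth_pd j).of_le (WithTop.coe_le_coe.2 le_top)
  obtain ⟨S, hS, hSpd⟩ := exists_potential hq
    ![fun y => ⟪L y, pd 0 Φ y⟫ + gradDens Φ Y 1 y, fun y => ⟪L y, pd 1 Φ y⟫ - gradDens Φ Y 0 y]
    (fun j => by
      fin_cases j
      · exact (hLq.inner ℝ (hp 0)).add (hY' 1)
      · exact (hLq.inner ℝ (hp 1)).sub (hY' 0))
    (fun x hx => by
      have hd : ∀ j, DifferentiableAt ℝ (gradDens Φ Y j) x := fun j =>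
        differentiableAt_of_one_le hq (hY' j) hx
      have hLd := differentiableAt_of_one_le hq hLq hx
      have hpd : ∀ j, DifferentiableAt ℝ (pd j Φ) x := fun j =>
        differentiableAt_of_one_le hq (hp j) hx
      have h1 := h.sum_inner_gradDens hx (hY x hx)
      have h2 := h.sum_inner_stress hx
      simp only [Matrix.cons_val_zero, Matrix.cons_val_one]
      rw [pd_sub (hLd.inner ℝ (hpd 1)) (hd 0), pd_add (hLd.inner ℝ (hpd 0)) (hd 1),
        pd_inner hLd (hpd 1), pd_inner hLd (hpd 0), (hLpd x hx).1, (hLpd x hx).2,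
        h.pd_comm hx 0 1]
      simp only [Fin.sum_univ_two] at h1 h2
      simp only [inner_sub_left]
      linarith)
  exact ⟨S, hS, fun x hx => ⟨hSpd x hx 0, hSpd x hx 1⟩⟩

/-- As for S, but T ∧ dΦ is only a divergence, so H ∧ ∇Φ must be added to ∇X. -/
theorem exists_bivec_potential {X : Plane → BiVec m} (hXr : ContDiffOn ℝ (q + 1 : ℕ∞) X disk)
    (hX : ∀ x ∈ disk, laplace Φ X x = ∑ j, wedge (gradUp Φ V j x) (pd j Φ x)) :
    ∃ R : Plane → BiVec m, ContDiffOn ℝ (q + 1 : ℕ∞) R disk ∧ ∀ x ∈ disk,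
      pd 0 R x = wedge (L x) (pd 0 Φ x)
        + (gradDens Φ X 1 x + wedge (meanCurv Φ x) (gradDens Φ Φ 1 x)) ∧
      pd 1 R x = wedge (L x) (pd 1 Φ x)
        - (gradDens Φ X 0 x + wedge (meanCurv Φ x) (gradDens Φ Φ 0 x)) := by
  have hX' : ∀ j, ContDiffOn ℝ q (gradDens Φ X j) disk := h.contDiffOn_gradDens hXr le_rfl
  have hLq : ContDiffOn ℝ q L disk := hL.of_le (WithTop.coe_le_coe.2 le_self_add)
  have hp : ∀ j, ContDiffOn ℝ q (pd j Φ) disk := fun j =>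
    (h.smooth_pd j).of_le (WithTop.coe_le_coe.2 le_top)
  have hH : ∀ j, ContDiffOn ℝ q (fun y => wedge (meanCurv Φ y) (gradDens Φ Φ j y)) disk :=
    fun j => (contDiffOn_wedge h.smooth_meanCurv (h.smooth_gradDens h.smooth j)).of_le
      (WithTop.coe_le_coe.2 le_top)
  obtain ⟨R, hR, hRpd⟩ := exists_potential hq
    ![fun y => wedge (L y) (pd 0 Φ y)
        + (gradDens Φ X 1 y + wedge (meanCurv Φ y) (gradDens Φ Φ 1 y)),
      fun y => wedge (L y) (pd 1 Φ y)
        - (gradDens Φ X 0 y + wedge (meanCurv Φ y) (gradDens Φ Φ 0 y))]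
    (fun j => by
      fin_cases j
      · exact (contDiffOn_wedge hLq (hp 0)).add ((hX' 1).add (hH 1))
      · exact (contDiffOn_wedge hLq (hp 1)).sub ((hX' 0).add (hH 0)))
    (fun x hx => by
      have hd : ∀ j, DifferentiableAt ℝ (gradDens Φ X j) x := fun j =>
        differentiableAt_of_one_le hq (hX' j) hx
      have hdH := fun j => differentiableAt_of_one_le hq (hH j) hx
      have hLd := differentiableAt_of_one_le hq hLq hx
      have hpd : ∀ j, DifferentiableAt ℝ (pd j Φ) x := fun j =>
        differentiableAt_of_one_le hq (hp j) hx
      have hdw : ∀ j, DifferentiableAt ℝ (fun y => wedge (L y) (pd j Φ y)) x := fun j =>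
        differentiableAt_of_one_le hq (contDiffOn_wedge hLq (hp j)) hx
      have h1 := h.sum_wedge_gradDens hx (hX x hx)
      have h2 := h.sum_wedge_stress hx
      simp only [Matrix.cons_val_zero, Matrix.cons_val_one]
      rw [pd_sub (hdw 1) ((hd 0).fun_add (hdH 0)), pd_add (hdw 0) ((hd 1).fun_add (hdH 1)),
        pd_add (hd 0) (hdH 0), pd_add (hd 1) (hdH 1),
        pd_wedge hLd (hpd 1), pd_wedge hLd (hpd 0), (hLpd x hx).1, (hLpd x hx).2,
        h.pd_comm hx 0 1]
      simp only [Fin.sum_univ_two] at h1 h2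
      simp only [wedge_sub_left]
      linear_combination (norm := module) (-1 : ℝ) • h1 + (-1 : ℝ) • h2)
  exact ⟨R, hR, fun x hx => ⟨hRpd x hx 0, hRpd x hx 1⟩⟩

end IsImmersion

/-! ### The equations -/

namespace IsImmersion

variable (h : IsImmersion Φ) {L : Plane → Amb m} {S Y : Plane → ℝ} {X R : Plane → BiVec m}
  {x : Plane} (hx : x ∈ disk)
  (hS : pd 0 S x = ⟪L x, pd 0 Φ x⟫ + gradDens Φ Y 1 x ∧
      pd 1 S x = ⟪L x, pd 1 Φ x⟫ - gradDens Φ Y 0 x)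
  (hR : pd 0 R x = wedge (L x) (pd 0 Φ x)
        + (gradDens Φ X 1 x + wedge (meanCurv Φ x) (gradDens Φ Φ 1 x)) ∧
      pd 1 R x = wedge (L x) (pd 1 Φ x)
        - (gradDens Φ X 0 x + wedge (meanCurv Φ x) (gradDens Φ Φ 0 x)))

include h hx hS hR

omit hS hR in
/-- `(|g|^{1/2} gʲᵏ)` has determinant one. -/
theorem densInv_det : densInv Φ 0 0 x * densInv Φ 1 1 x - densInv Φ 0 1 x ^ 2 = 1 := by
  obtain ⟨e1, e2, e3, e4⟩ := h.densInv_eq hx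
  have hs := h.sqrtg_ne hx
  have hs2 := h.sqrtg_sq hx
  rw [e1, e2, e4]
  field_simp
  linarith

omit hS hR in
theorem inner_starN_meanCurv_wedge (l : Fin 2) :
    ⟪starN Φ x, wedge (meanCurv Φ x) (gradDens Φ Φ l x)⟫ = 0 := by
  have : ∀ k, ⟪pd k Φ x, meanCurv Φ x⟫ = 0 := fun k => by
    rw [real_inner_comm, h.inner_meanCurv hx]
  rw [starN_eq, real_inner_smul_left, inner_wedge_wedge, this, this]
  ring

/-- The terms with L match by `inner_starN_wedge`, and ⋆n does not see H ∧ ∇Φ because H is normal. Y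
is rotated twice, which is where the unit determinant of the density enters. -/
theorem gradDens_scalar (j : Fin 2) : gradDens Φ S j x
    = rotProd (innerSL ℝ) (starN Φ) R j x + rotGrad Y j x
      + sqrtg Φ x * ⟪starN Φ x, gradUp Φ X j x⟫ := by
  have hdet := h.densInv_det hx
  have h1 := h.inner_starN_wedge hx (L x) j
  have h2 := fun l => h.inner_starN_meanCurv_wedge hx l
  have hin : ∀ α β : BiVec m, innerSL ℝ α β = ⟪α, β⟫ := fun _ _ => rfl
  rw [← real_inner_smul_right, sqrtg_smul_gradUp, gradDens]
  fin_cases j <;>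
  simp only [rotProd, rotGrad, Fin.sum_univ_two, hS.1, hS.2, hR.1, hR.2, hin,
    inner_add_right, inner_sub_right, h2, eps, Fin.zero_eta, Fin.mk_one, Matrix.cons_val_zero,
    Matrix.cons_val_one, smul_eq_mul] at h1 ⊢
  · simp only [gradDens, Fin.sum_univ_two, smul_eq_mul, densInv_symm x 1 0] at h1 ⊢
    linear_combination pd 1 Y x * hdet - h1
  · simp only [gradDens, Fin.sum_univ_two, smul_eq_mul, densInv_symm x 1 0] at h1 ⊢
    linear_combination -pd 0 Y x * hdet - h1

theorem gradDens_bivec (j : Fin 2) : gradDens Φ R j x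
    = - (rotProd (ContinuousLinearMap.lsmul ℝ ℝ).flip (starN Φ) S j x
        + rotProd bulletL (starN Φ) R j x) + rotGrad X j x
      - sqrtg Φ x • (gradUp Φ Y j x • starN Φ x + bullet (starN Φ x) (gradUp Φ X j x)) := by
  have hdet := h.densInv_det hx
  have h1 := h.bullet_starN_wedge hx (h.inner_meanCurv hx) (L x) j
  have hsc : ∀ (c : ℝ) (α : BiVec m), (ContinuousLinearMap.lsmul ℝ ℝ).flip α c = c • α :=
    fun _ _ => rfl
  have h2 : sqrtg Φ x • (gradUp Φ Y j x • starN Φ x + bullet (starN Φ x) (gradUp Φ X j x))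
      = gradDens Φ Y j x • starN Φ x + bullet (starN Φ x) (gradDens Φ X j x) := by
    rw [← sqrtg_smul_gradUp, ← sqrtg_smul_gradUp, bullet_smul_right, smul_add, smul_assoc]
  have h3 : ∀ l, wedge (meanCurv Φ x) (gradDens Φ Φ l x)
      = ∑ k, densInv Φ l k x • wedge (meanCurv Φ x) (pd k Φ x) := fun l => by
    simp only [gradDens, Fin.sum_univ_two, wedge_add_right, wedge_smul_right]
  rw [h2, gradDens]
  fin_cases j <;>
  simp only [rotProd, rotGrad, Fin.sum_univ_two, hS.1, hS.2, hR.1, hR.2, hsc, bulletL_apply, h3, eps,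
    Fin.zero_eta, Fin.mk_one, Matrix.cons_val_zero, Matrix.cons_val_one, sub_eq_add_neg,
    bullet_add_right, bullet_neg_right, bullet_smul_right] at h1 ⊢
  · simp only [gradDens, Fin.sum_univ_two, densInv_symm x 1 0, bullet_add_right,
      bullet_smul_right] at h1 ⊢
    -- The contraction identity absorbs L and H; the unit determinant undoes the double rotation of
    -- X and of H ∧ dΦ.
    linear_combination (norm := module) (1 : ℝ) • h1 + hdet • pd 1 X x
      + hdet • wedge (meanCurv Φ x) (pd 1 Φ x)
  · simp only [gradDens, Fin.sum_univ_two, densInv_symm x 1 0, bullet_add_right,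
      bullet_smul_right] at h1 ⊢
    linear_combination (norm := module) (1 : ℝ) • h1 - hdet • pd 0 X x
      - hdet • wedge (meanCurv Φ x) (pd 0 Φ x)

theorem laplace_immersion : sqrtg Φ x • laplace Φ Φ x
    = - (∑ j, ∑ k, eps j k • (pd j S x • pd k Φ x + contract (pd j R x) (pd k Φ x)))
      + sqrtg Φ x • ∑ j,
        (gradUp Φ Y j x • pd j Φ x + contract (gradUp Φ X j x) (pd j Φ x)) := by
  have h1 : sqrtg Φ x • ∑ j, (gradUp Φ Y j x • pd j Φ x + contract (gradUp Φ X j x) (pd j Φ x))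
      = ∑ j, (gradDens Φ Y j x • pd j Φ x + contract (gradDens Φ X j x) (pd j Φ x)) := by
    simp only [← sqrtg_smul_gradUp, contract_smul_left, smul_eq_mul, Finset.smul_sum, smul_add,
      mul_smul]
  have h2 : ∀ j, ⟪gradDens Φ Φ j x, pd j Φ x⟫ = sqrtg Φ x := fun j => by
    rw [h.inner_gradDens_pd hx, if_pos rfl]
  rw [h1, h.sqrtg_smul_laplace hx, h.div_gradDens hx]
  simp only [Fin.sum_univ_two, eps, Matrix.cons_val_zero, Matrix.cons_val_one, hS.1, hS.2, hR.1,
    hR.2, sub_eq_add_neg, contract_add_left, contract_neg_left, contract_wedge,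
    h.inner_meanCurv hx, h2, real_inner_comm (pd 0 Φ x) (pd 1 Φ x)]
  module

end IsImmersion

end Potentials

/-! ### Second-order equations as divergences of the first-order relations -/

section Divergence

variable {m : ℕ} {Φ : Plane → Amb m}

namespace IsImmersion

variable (h : IsImmersion Φ) {q : ℕ∞} (hq : 1 ≤ q) {S Y : Plane → ℝ} {X R : Plane → BiVec m}
  (hSr : ContDiffOn ℝ (q + 1 : ℕ∞) S disk) (hRr : ContDiffOn ℝ (q + 1 : ℕ∞) R disk)
  (hXr : ContDiffOn ℝ (q + 1 : ℕ∞) X disk) (hYr : ContDiffOn ℝ (q + 1 : ℕ∞) Y disk)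

include h hq hRr hXr hYr

theorem laplace_scalar
    (hgrad : ∀ x ∈ disk, ∀ j, gradDens Φ S j x
      = rotProd (innerSL ℝ) (starN Φ) R j x + rotGrad Y j x
        + sqrtg Φ x * ⟪starN Φ x, gradUp Φ X j x⟫) {x : Plane} (hx : x ∈ disk) :
    sqrtg Φ x * laplace Φ S x
      = (∑ j, ∑ k, eps j k * ⟪pd j (starN Φ) x, pd k R x⟫)
        + sqrtg Φ x * covDiv Φ (fun j y => ⟪starN Φ y, gradUp Φ X j y⟫) x := by
  have hN : ContDiffOn ℝ q (starN Φ) disk := h.smooth_starN.of_le (WithTop.coe_le_coe.2 le_top)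
  have h2 : (2 : WithTop ℕ∞) ≤ (q + 1 : ℕ∞) := two_le_coe_add_one hq
  have hd1 : ∀ j, DifferentiableAt ℝ (rotProd (innerSL ℝ) (starN Φ) R j) x := fun j =>
    differentiableAt_of_one_le hq (contDiffOn_rotProd _ hN hRr j) hx
  have hd2 : ∀ j, DifferentiableAt ℝ (rotGrad Y j) x := fun j =>
    differentiableAt_of_one_le hq (contDiffOn_rotGrad hYr j) hx
  have hd3 : ∀ j, DifferentiableAt ℝ (fun y => sqrtg Φ y * ⟪starN Φ y, gradUp Φ X j y⟫) x := by
    intro j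
    -- Absorbing |g|^{1/2} into the gradient exposes a product of C^q fields.
    simp only [← real_inner_smul_right, sqrtg_smul_gradUp]
    exact differentiableAt_of_one_le hq
      (hN.inner ℝ (h.contDiffOn_gradDens hXr le_rfl j)) hx
  have e1 := h.sqrtg_smul_laplace hx S
  have e2 := h.sqrtg_smul_covDiv hx (fun j y => ⟪starN Φ y, gradUp Φ X j y⟫)
  simp only [smul_eq_mul] at e1 e2
  have e3 : ∀ j, pd j (gradDens Φ S j) x = pd j (rotProd (innerSL ℝ) (starN Φ) R j) x
      + pd j (rotGrad Y j) x
      + pd j (fun y => sqrtg Φ y * ⟪starN Φ y, gradUp Φ X j y⟫) x := fun j => by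
    rw [pd_congr (fun y hy => hgrad y hy j) j hx, pd_add ((hd1 j).fun_add (hd2 j)) (hd3 j),
      pd_add (hd1 j) (hd2 j)]
  rw [e1, e2]
  simp only [e3, Finset.sum_add_distrib]
  rw [div_rotProd _ hx (differentiableAt_of_one_le hq hN hx) hRr h2, div_rotGrad hx hYr h2,
    add_zero]
  rfl

include hSr

theorem laplace_bivec
    (hgrad : ∀ x ∈ disk, ∀ j, gradDens Φ R j x
      = - (rotProd (ContinuousLinearMap.lsmul ℝ ℝ).flip (starN Φ) S j x
          + rotProd bulletL (starN Φ) R j x) + rotGrad X j x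
        - sqrtg Φ x • (gradUp Φ Y j x • starN Φ x + bullet (starN Φ x) (gradUp Φ X j x)))
    {x : Plane} (hx : x ∈ disk) :
    sqrtg Φ x • laplace Φ R x
      = - ((∑ j, ∑ k, eps j k •
          (pd k S x • pd j (starN Φ) x + bullet (pd j (starN Φ) x) (pd k R x)))
        + sqrtg Φ x • covDiv Φ (fun j y =>
            gradUp Φ Y j y • starN Φ y + bullet (starN Φ y) (gradUp Φ X j y)) x) := by
  have hN : ContDiffOn ℝ q (starN Φ) disk := h.smooth_starN.of_le (WithTop.coe_le_coe.2 le_top)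
  have h2 : (2 : WithTop ℕ∞) ≤ (q + 1 : ℕ∞) := two_le_coe_add_one hq
  have hd0 : ∀ j, DifferentiableAt ℝ
      (rotProd (ContinuousLinearMap.lsmul ℝ ℝ).flip (starN Φ) S j) x := fun j =>
    differentiableAt_of_one_le hq (contDiffOn_rotProd _ hN hSr j) hx
  have hd1 : ∀ j, DifferentiableAt ℝ (rotProd bulletL (starN Φ) R j) x := fun j =>
    differentiableAt_of_one_le hq (contDiffOn_rotProd _ hN hRr j) hx
  have hd2 : ∀ j, DifferentiableAt ℝ (rotGrad X j) x := fun j =>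
    differentiableAt_of_one_le hq (contDiffOn_rotGrad hXr j) hx
  have hd3 : ∀ j, DifferentiableAt ℝ (fun y => sqrtg Φ y •
      (gradUp Φ Y j y • starN Φ y + bullet (starN Φ y) (gradUp Φ X j y))) x := by
    intro j
    simp only [smul_add, ← smul_assoc, ← bullet_smul_right, sqrtg_smul_gradUp]
    exact differentiableAt_of_one_le hq
      (((h.contDiffOn_gradDens hYr le_rfl j).smul hN).add
        (contDiffOn_bullet hN (h.contDiffOn_gradDens hXr le_rfl j))) hx
  have e3 : ∀ j, pd j (gradDens Φ R j) x
      = - (pd j (rotProd (ContinuousLinearMap.lsmul ℝ ℝ).flip (starN Φ) S j) x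
        + pd j (rotProd bulletL (starN Φ) R j) x) + pd j (rotGrad X j) x
      - pd j (fun y => sqrtg Φ y •
          (gradUp Φ Y j y • starN Φ y + bullet (starN Φ y) (gradUp Φ X j y))) x := fun j => by
    rw [pd_congr (fun y hy => hgrad y hy j) j hx,
      pd_sub (((hd0 j).fun_add (hd1 j)).fun_neg.fun_add (hd2 j)) (hd3 j),
      pd_add ((hd0 j).fun_add (hd1 j)).fun_neg (hd2 j), pd_neg, pd_add (hd0 j) (hd1 j)]
  have hNd := differentiableAt_of_one_le hq hN hx
  rw [h.sqrtg_smul_laplace hx, h.sqrtg_smul_covDiv hx]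
  simp only [e3, Finset.sum_add_distrib, Finset.sum_sub_distrib, Finset.sum_neg_distrib]
  rw [div_rotProd _ hx hNd hRr h2, div_rotProd _ hx hNd hSr h2, div_rotGrad hx hXr h2]
  simp only [smul_add, Finset.sum_add_distrib, bulletL_apply, ContinuousLinearMap.flip_apply,
    ContinuousLinearMap.lsmul_apply]
  abel

end IsImmersion

end Divergence

end WillmoreSystem

end

theorem theorem1p3 (m : ℕ) (hm : 3 ≤ m)
    -- the immersion and its Willmore operator
    (Φ : Plane → Amb m) (hΦ : ContDiffOn ℝ ∞ Φ disk)
    (himm : ∀ x ∈ disk, Function.Injective (fderiv ℝ Φ x))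
    (W : Plane → Amb m) (hW : ∀ x ∈ disk, willmoreOp Φ x = W x)
    -- the regularity class, `2 ≤ r ≤ ∞`, of the solutions `V`, `X`, `Y`
    (r : ℕ∞) (hr : 2 ≤ r)
    (V : Plane → Amb m) (X : Plane → BiVec m) (Y : Plane → ℝ)
    (hVr : ContDiffOn ℝ r V disk) (hXr : ContDiffOn ℝ r X disk) (hYr : ContDiffOn ℝ r Y disk)
    (hV : ∀ x ∈ disk, laplace Φ V x = - W x)
    (hX : ∀ x ∈ disk, laplace Φ X x = ∑ j, wedge (gradUp Φ V j x) (pd j Φ x))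
    (hY : ∀ x ∈ disk, laplace Φ Y x = ∑ j, inner ℝ (gradUp Φ V j x) (pd j Φ x)) :
    ∃ (S : Plane → ℝ) (R : Plane → BiVec m),
      ContDiffOn ℝ r S disk ∧ ContDiffOn ℝ r R disk ∧
      ∀ x ∈ disk,
        -- the equation for `S`
        (sqrtg Φ x * laplace Φ S x
          = (∑ j, ∑ k, eps j k * inner ℝ (pd j (starN Φ) x) (pd k R x))
            + sqrtg Φ x * covDiv Φ (fun j y => inner ℝ (starN Φ y) (gradUp Φ X j y)) x) ∧
        -- the equation for `R`
        (sqrtg Φ x • laplace Φ R x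
          = - ((∑ j, ∑ k, eps j k •
                (pd k S x • pd j (starN Φ) x + bullet (pd j (starN Φ) x) (pd k R x)))
              + sqrtg Φ x • covDiv Φ (fun j y =>
                  gradUp Φ Y j y • starN Φ y + bullet (starN Φ y) (gradUp Φ X j y)) x)) ∧
        -- the equation for `Φ`
        (sqrtg Φ x • laplace Φ Φ x
          = - (∑ j, ∑ k, eps j k • (pd j S x • pd k Φ x + contract (pd j R x) (pd k Φ x)))
            + sqrtg Φ x • ∑ j,
                (gradUp Φ Y j x • pd j Φ x + contract (gradUp Φ X j x) (pd j Φ x))) := by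
  have h : IsImmersion Φ := ⟨hΦ, himm⟩
  -- The gradients of V, X, Y have class C^q and each primitive regains the lost derivative, so S
  -- and R reach C^r; q ≥ 1 lets curls be taken classically, and r = ∞ gives q = ∞.
  obtain ⟨q, rfl⟩ : ∃ q : ℕ∞, r = q + 1 := by
    obtain ⟨c, rfl⟩ := exists_add_of_le (le_trans one_le_two hr)
    exact ⟨c, add_comm _ _⟩
  have hq : 1 ≤ q := by
    rw [← one_add_one_eq_two] at hr
    exact (ENat.add_le_add_iff_right ENat.one_ne_top).1 hr
  obtain ⟨L, hL, hLpd⟩ := h.exists_stress_potential hq hVr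
    (fun x hx => by rw [hV x hx, hW x hx])
  obtain ⟨S, hSr, hS⟩ := h.exists_scalar_potential hq hL hLpd hYr hY
  obtain ⟨R, hRr, hR⟩ := h.exists_bivec_potential hq hL hLpd hXr hX
  refine ⟨S, R, hSr, hRr, fun x hx => ⟨?_, ?_, ?_⟩⟩
  · exact h.laplace_scalar hq hRr hXr hYr
      (fun y hy => h.gradDens_scalar hy (hS y hy) (hR y hy)) hx
  · exact h.laplace_bivec hq hSr hRr hXr hYr
      (fun y hy => h.gradDens_bivec hy (hS y hy) (hR y hy)) hx
  · exact h.laplace_immersion hx (hS x hx) (hR x hx)
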